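/- All algebras are over $\mathbb{C}$, with or without identity, but with non-degenerate product; $M(A)$ denotes the multiplier algebra of $A$, and products of subspaces are linear spans of products of their elements. A multiplier Hopf algebra $(A,\Delta)$ is such an algebra with a homomorphism $\Delta:A\to M(A\otimes A)$ such that $T_1(a\otimes b)=\Delta(a)(1\otimes b)$ and $T_2(a\otimes b)=(a\otimes 1)\Delta(b)$ define bijective linear maps from $A\otimes A$ to $A\otimes A$ and $(a\otimes 1\otimes 1)(\Delta\otimes\iota)(\Delta(b)(1\otimes c))=(\iota\otimes\Delta)((a\otimes 1)\Delta(b))(1\otimes 1\otimes c)$ for all $a,b,c\in A$, where $\iota$ is the identity map. It is regular if $(A,\Delta^{\mathrm{op}})$, with $\Delta^{\mathrm{op}}$ the composition of $\Delta$ with the flip, is a multiplier Hopf algebra as well. For a group $G$, it is $G$-cograded if there are non-zero subalgebras $(A_p)_{p\in G}$ of $A$ with $A=\bigoplus_{p\in G}A_p$, $A_pA_q=0$ for $p\ne q$, and $\Delta(A_{pq})(1\otimes A_q)=A_p\otimes A_q=(A_p\otimes 1)\Delta(A_{pq})$ for all $p,q\in G$. Then $M(A)=\prod_p M(A_p)$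 and $M(A\otimes A)=\prod_{p,q}M(A_p\otimes A_q)$; write $m_p\in M(A_p)$ for the components (restrictions to $A_p$) of $m\in M(A)$, $\varphi_p$ for the restriction to $A_p$ of a linear functional $\varphi$ on $A$, and $\Delta_{p,q}:A_{pq}\to M(A_p\otimes A_q)$ for the map sending $a\in A_{pq}$ to the $(p,q)$-component of $\Delta(a)$. A left integral is a non-zero linear functional $\varphi$ on $A$ with $(\iota\otimes\varphi)\Delta(a)=\varphi(a)1$ in $M(A)$ for all $a\in A$. Here $(\iota\otimes\varphi)\Delta(a)$ is the multiplier $n$ with $nb=(\iota\otimes\varphi)(\Delta(a)(b\otimes 1))$ and $bn=(\iota\otimes\varphi)((b\otimes 1)\Delta(a))$ for all $b\in A$; similarly, for $m\in M(B\otimes C)$ with $m(1\otimes c),(1\otimes c)m\in B\otimes C$ for all $c\in C$, and a linear functional $\omega$ on $B$, $(\omega\otimes\iota)(m)$ is the multiplier $n\in M(C)$ with $nc=(\omega\otimes\iota)(m(1\otimes c))$ and $cn=(\omega\otimes\iota)((1\otimes c)m)$ for all $c\in C$. **Proposition.** Let $(A,\Delta)$ be a regular $G$-cograded multiplier Hopf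 algebra with decomposition $A=\bigoplus_{p\in G}A_p$, and let $\varphi$ be a left integral on $A$. There is a unique multiplier $\delta\in M(A)$ (the modular element) such that $(\varphi\otimes\iota)\Delta(a)=\varphi(a)\delta$ for all $a\in A$. For all $p,q\in G$, its components satisfy: 1. for all $a\in A_{pq}$, the multiplier $(\varphi_p\otimes\iota)\Delta_{p,q}(a)\in M(A_q)$ is defined, and $(\varphi_p\otimes\iota)\Delta_{p,q}(a)=\varphi_{pq}(a)\,\delta_q$; 2. $\Delta_{p,q}$ has a unique extension to a unital homomorphism $M(A_{pq})\to M(A_p\otimes A_q)$, and, denoting it by $\Delta_{p,q}$ as well, $\Delta_{p,q}(\delta_{pq})(b\otimes c)=\delta_p b\otimes\delta_q c$ for all $b\in A_p$, $c\in A_q$. -/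

import Mathlib

open scoped TensorProduct

noncomputable section

namespace CogradedMHA

section Multipliers

variable (A : Type*) [NonUnitalRing A] [Module ℂ A] [SMulCommClass ℂ A A] [IsScalarTower ℂ A A]
variable (B : Type*) [NonUnitalRing B] [Module ℂ B] [SMulCommClass ℂ B B] [IsScalarTower ℂ B B]

/-- The product of `A` is non-degenerate. -/
def NondegenerateProduct : Prop :=
  (∀ a : A, (∀ b : A, a * b = 0) → a = 0) ∧ (∀ b : A, (∀ a : A, a * b = 0) → b = 0)

/-- The multiplier algebra `M(A)` of an algebra with non-degenerate product: pairs `(L, R)` of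
linear maps with `R(a) b = a L(b)`, where `L(b)` plays the role of `m b` and `R(a)` that of `a m`.
(The rules `L(ab) = L(a)b` and `R(ab) = aR(b)` follow by non-degeneracy.) -/
def multiplierAlgebra : Subalgebra ℂ (Module.End ℂ A × (Module.End ℂ A)ᵐᵒᵖ) where
  carrier := {m | ∀ a b : A, m.2.unop a * b = a * m.1 b}
  mul_mem' := by
    intro m n hm hn a b
    simp only [Set.mem_ofPred_eq] at hm hn
    simp [hm, hn]
  add_mem' := by
    intro m n hm hn a b
    simp only [Set.mem_ofPred_eq] at hm hn
    simp [hm, hn, add_mul, mul_add]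
  algebraMap_mem' := by
    intro r a b
    simp [Algebra.algebraMap_eq_smul_one, smul_mul_assoc, mul_smul_comm]

/-- The type of multipliers of `A`. -/
def Mult : Type _ := ↥(multiplierAlgebra A)

instance : Ring (Mult A) := inferInstanceAs (Ring ↥(multiplierAlgebra A))

instance : Algebra ℂ (Mult A) := inferInstanceAs (Algebra ℂ ↥(multiplierAlgebra A))

variable {A B}

namespace Mult

/-- `m.left b` is the product `m b`. -/
def left (m : Mult A) : A →ₗ[ℂ] A := m.1.1

/-- `m.right a` is the product `a m`. -/
def right (m : Mult A) : A →ₗ[ℂ] A := m.1.2.unop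

theorem central (m : Mult A) (a b : A) : m.right a * b = a * m.left b := m.2 a b

/-- A multiplier from its left and right actions. -/
def mk (L R : A →ₗ[ℂ] A) (h : ∀ a b : A, R a * b = a * L b) : Mult A :=
  ⟨(L, MulOpposite.op R), h⟩

/-- The canonical map `A → M(A)`. -/
def incl (a : A) : Mult A :=
  mk (LinearMap.mulLeft ℂ a) (LinearMap.mulRight ℂ a) (fun x y => by simp [mul_assoc])

/-- The multiplier `m ⊗ n` of `A ⊗ B`. -/
def tmul (m : Mult A) (n : Mult B) : Mult (A ⊗[ℂ] B) :=
  mk (TensorProduct.map m.left n.left) (TensorProduct.map m.right n.right) (by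
    intro x y
    induction x using TensorProduct.induction_on with
    | zero => simp
    | add x x' hx hx' => simp [add_mul, hx, hx']
    | tmul a b =>
      induction y using TensorProduct.induction_on with
      | zero => simp
      | add y y' hy hy' => rw [mul_add, hy, hy', map_add, mul_add]
      | tmul c d => simp [central])

theorem comm_mul (x y : A ⊗[ℂ] B) :
    TensorProduct.comm ℂ A B (x * y) = TensorProduct.comm ℂ A B x * TensorProduct.comm ℂ A B y := by
  induction x using TensorProduct.induction_on with
  | zero => simp
  | add x x' hx hx' => simp [add_mul, hx, hx']
  | tmul a b =>
    induction y using TensorProduct.induction_on with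
    | zero => simp
    | add y y' hy hy' => rw [mul_add, map_add, hy, hy', map_add, mul_add]
    | tmul c d => simp

/-- The flip `M(A ⊗ B) → M(B ⊗ A)`, extending `a ⊗ b ↦ b ⊗ a`. -/
def flip (m : Mult (A ⊗[ℂ] B)) : Mult (B ⊗[ℂ] A) :=
  mk (TensorProduct.comm ℂ A B ∘ₗ m.left ∘ₗ TensorProduct.comm ℂ B A)
    (TensorProduct.comm ℂ A B ∘ₗ m.right ∘ₗ TensorProduct.comm ℂ B A) (by
    intro x y
    apply (TensorProduct.comm ℂ B A).injective
    rw [comm_mul, comm_mul]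
    have h : ∀ z : A ⊗[ℂ] B, TensorProduct.comm ℂ B A (TensorProduct.comm ℂ A B z) = z :=
      fun z => (TensorProduct.comm ℂ A B).symm_apply_apply z
    simp only [LinearMap.comp_apply, LinearEquiv.coe_coe, h]
    exact m.central _ _)

/-- Let `j : B → A` be an algebra embedding with a linear retraction `π` that is a `B`-bimodule map.
This sends a multiplier `m` of `A` to the multiplier `b ↦ π(m j(b))`, `b ↦ π(j(b) m)` of `B`. If
`m j(B) ⊆ j(B)` and `j(B) m ⊆ j(B)` (as for the components below), it is the restriction
of `m` to `B`. -/
def compress (j : B →ₗ[ℂ] A) (π : A →ₗ[ℂ] B) (hl : ∀ a b, π (j b * a) = b * π a)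
    (hr : ∀ a b, π (a * j b) = π a * b) (m : Mult A) : Mult B :=
  mk (π ∘ₗ m.left ∘ₗ j) (π ∘ₗ m.right ∘ₗ j) (by
    intro x y
    simp only [LinearMap.comp_apply]
    rw [← hr, ← hl, central])

end Mult

/-- `n = (φ ⊗ ι)(m)` for `m` in `M(A ⊗ B)` and `n` in `M(B)`: for all `b` in `B`, the products
`m(1 ⊗ b)` and `(1 ⊗ b)m` belong to `A ⊗ B`, and `n b = (φ ⊗ ι)(m(1 ⊗ b))`,
`b n = (φ ⊗ ι)((1 ⊗ b)m)`. -/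
def IsLeftSlice (φ : A →ₗ[ℂ] ℂ) (m : Mult (A ⊗[ℂ] B)) (n : Mult B) : Prop :=
  ∀ b : B,
    (∃ x : A ⊗[ℂ] B, Mult.incl x = m * Mult.tmul 1 (Mult.incl b) ∧
      TensorProduct.lid ℂ B (φ.rTensor B x) = n.left b) ∧
    (∃ x : A ⊗[ℂ] B, Mult.incl x = Mult.tmul 1 (Mult.incl b) * m ∧
      TensorProduct.lid ℂ B (φ.rTensor B x) = n.right b)

/-- `n = (ι ⊗ φ)(m)` for `m` in `M(A ⊗ B)` and `n` in `M(A)`: for all `a` in `A`, the products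
`m(a ⊗ 1)` and `(a ⊗ 1)m` belong to `A ⊗ B`, and `n a = (ι ⊗ φ)(m(a ⊗ 1))`,
`a n = (ι ⊗ φ)((a ⊗ 1)m)`. -/
def IsRightSlice (φ : B →ₗ[ℂ] ℂ) (m : Mult (A ⊗[ℂ] B)) (n : Mult A) : Prop :=
  ∀ a : A,
    (∃ x : A ⊗[ℂ] B, Mult.incl x = m * Mult.tmul (Mult.incl a) 1 ∧
      TensorProduct.rid ℂ A (φ.lTensor A x) = n.left a) ∧
    (∃ x : A ⊗[ℂ] B, Mult.incl x = Mult.tmul (Mult.incl a) 1 * m ∧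
      TensorProduct.rid ℂ A (φ.lTensor A x) = n.right a)

/-- A unital homomorphism `M(A) → M(B)` which extends `α : A → M(B)`. -/
def IsMultExtension (α : A → Mult B) (D : Mult A →ₐ[ℂ] Mult B) : Prop :=
  ∀ a : A, D (Mult.incl a) = α a

end Multipliers

section MultiplierHopf

variable {A : Type*} [NonUnitalRing A] [Module ℂ A] [SMulCommClass ℂ A A] [IsScalarTower ℂ A A]

/-- `(A, Δ)` is a multiplier Hopf algebra: the product of `A` is non-degenerate, `Δ(a)(1 ⊗ b)` and
`(a ⊗ 1)Δ(b)` belong to `A ⊗ A`, the maps `T₁(a ⊗ b) = Δ(a)(1 ⊗ b)` and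
`T₂(a ⊗ b) = (a ⊗ 1)Δ(b)` are bijections of `A ⊗ A`, and `Δ` is coassociative:
`(a ⊗ 1 ⊗ 1)((Δ ⊗ ι)(Δ(b)(1 ⊗ c))) = ((ι ⊗ Δ)((a ⊗ 1)Δ(b)))(1 ⊗ 1 ⊗ c)`, where the left side
is `(T₂ ⊗ ι)(a ⊗ T₁(b ⊗ c))` and the right side is `(ι ⊗ T₁)(T₂(a ⊗ b) ⊗ c)`. -/
def IsMultiplierHopfAlgebra (Δ : A → Mult (A ⊗[ℂ] A)) : Prop :=
  NondegenerateProduct A ∧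
  ((∀ a b, Δ (a + b) = Δ a + Δ b) ∧ (∀ (r : ℂ) a, Δ (r • a) = r • Δ a) ∧
    (∀ a b, Δ (a * b) = Δ a * Δ b)) ∧
  ∃ T₁ T₂ : A ⊗[ℂ] A ≃ₗ[ℂ] A ⊗[ℂ] A,
    (∀ a b : A, Mult.incl (T₁ (a ⊗ₜ b)) = Δ a * Mult.tmul 1 (Mult.incl b)) ∧
    (∀ a b : A, Mult.incl (T₂ (a ⊗ₜ b)) = Mult.tmul (Mult.incl a) 1 * Δ b) ∧
    (∀ a b c : A,
      T₂.toLinearMap.rTensor A ((TensorProduct.assoc ℂ A A A).symm (a ⊗ₜ T₁ (b ⊗ₜ c))) =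
        (TensorProduct.assoc ℂ A A A).symm
          (T₁.toLinearMap.lTensor A (TensorProduct.assoc ℂ A A A (T₂ (a ⊗ₜ b) ⊗ₜ c))))

/-- A multiplier Hopf algebra `(A, Δ)` is regular if `(A, Δᵒᵖ)` is a multiplier Hopf algebra, too. -/
def IsRegularMultiplierHopfAlgebra (Δ : A → Mult (A ⊗[ℂ] A)) : Prop :=
  IsMultiplierHopfAlgebra Δ ∧ IsMultiplierHopfAlgebra (fun a => Mult.flip (Δ a))

/-- A left integral: `φ ≠ 0` and `(ι ⊗ φ)Δ(a) = φ(a)1` for all `a`. -/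
def IsLeftIntegral (Δ : A → Mult (A ⊗[ℂ] A)) (φ : A →ₗ[ℂ] ℂ) : Prop :=
  φ ≠ 0 ∧ ∀ a : A, IsRightSlice φ (Δ a) (φ a • (1 : Mult A))

/-- The defining property of the modular element: `(φ ⊗ ι)Δ(a) = φ(a)δ` for all `a`. -/
def IsModularElement (Δ : A → Mult (A ⊗[ℂ] A)) (φ : A →ₗ[ℂ] ℂ) (δ : Mult A) : Prop :=
  ∀ a : A, IsLeftSlice φ (Δ a) (φ a • δ)

end MultiplierHopf

section Cograding

variable {A : Type*} [NonUnitalRing A] [Module ℂ A] [SMulCommClass ℂ A A] [IsScalarTower ℂ A A]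
variable {G : Type*}

/-- The inclusion `A_p → A`. -/
def summandIncl (𝒜 : G → NonUnitalSubalgebra ℂ A) (p : G) : 𝒜 p →ₗ[ℂ] A :=
  (NonUnitalSubalgebraClass.subtype (𝒜 p) : 𝒜 p →ₗ[ℂ] A)

/-- `A` is the direct sum, as an algebra, of the subalgebras `A_p`: it is their direct sum as a
vector space, and `A_p A_q = 0` for `p ≠ q`. -/
structure IsAlgebraDirectSum [DecidableEq G] (𝒜 : G → NonUnitalSubalgebra ℂ A) : Prop where
  isInternal : DirectSum.IsInternal 𝒜
  mul_eq_zero : ∀ p q : G, p ≠ q → ∀ a ∈ 𝒜 p, ∀ b ∈ 𝒜 q, a * b = 0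

/-- `A` with the subalgebras `A_p` is `G`-cograded: the subalgebras are non-zero, `A` is their
direct sum, and `Δ(A_{pq})(1 ⊗ A_q) = A_p ⊗ A_q = (A_p ⊗ 1)Δ(A_{pq})`, with products of
subspaces understood as linear spans and everything considered inside `M(A ⊗ A)`. -/
structure IsCograding [Group G] [DecidableEq G] (Δ : A → Mult (A ⊗[ℂ] A))
    (𝒜 : G → NonUnitalSubalgebra ℂ A) : Prop extends IsAlgebraDirectSum 𝒜 where
  ne_bot : ∀ p : G, 𝒜 p ≠ ⊥
  span_right : ∀ p q : G,
    Submodule.span ℂ {m | ∃ a ∈ 𝒜 (p * q), ∃ b ∈ 𝒜 q, m = Δ a * Mult.tmul 1 (Mult.incl b)} =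
      Submodule.span ℂ {m | ∃ a ∈ 𝒜 p, ∃ b ∈ 𝒜 q, m = Mult.incl (a ⊗ₜ[ℂ] b)}
  span_left : ∀ p q : G,
    Submodule.span ℂ {m | ∃ a ∈ 𝒜 p, ∃ b ∈ 𝒜 (p * q), m = Mult.tmul (Mult.incl a) 1 * Δ b} =
      Submodule.span ℂ {m | ∃ a ∈ 𝒜 p, ∃ b ∈ 𝒜 q, m = Mult.incl (a ⊗ₜ[ℂ] b)}

namespace IsAlgebraDirectSum

variable [DecidableEq G] {𝒜 : G → NonUnitalSubalgebra ℂ A} (h : IsAlgebraDirectSum 𝒜)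

/-- The linear isomorphism of the external direct sum of the `A_p` with `A`. -/
def sumEquiv : (DirectSum G fun p => 𝒜 p) ≃ₗ[ℂ] A :=
  LinearEquiv.ofBijective (DirectSum.toModule ℂ G A (summandIncl 𝒜)) h.isInternal

/-- The projection of `A` on the summand `A_p`. -/
def proj (p : G) : A →ₗ[ℂ] 𝒜 p :=
  DirectSum.component ℂ G (fun p => 𝒜 p) p ∘ₗ h.sumEquiv.symm.toLinearMap

theorem proj_summandIncl (p q : G) (a : 𝒜 q) :
    h.proj p (summandIncl 𝒜 q a) = if e : q = p then e ▸ a else 0 := by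
  have : summandIncl 𝒜 q a = h.sumEquiv (DirectSum.lof ℂ G (fun p => 𝒜 p) q a) := by
    change _ = DirectSum.toModule ℂ G A (summandIncl 𝒜) (DirectSum.lof ℂ G (fun p => 𝒜 p) q a)
    simp
  rw [this]
  simp only [proj, LinearMap.comp_apply, LinearEquiv.coe_coe, LinearEquiv.symm_apply_apply]
  rw [DirectSum.component.of]

theorem sum_induction (h : IsAlgebraDirectSum 𝒜) {P : A → Prop} (h0 : P 0) (hadd : ∀ x y, P x → P y → P (x + y))
    (hincl : ∀ q (a : 𝒜 q), P (summandIncl 𝒜 q a)) (x : A) : P x := by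
  obtain ⟨y, rfl⟩ := h.sumEquiv.surjective x
  induction y using DirectSum.induction_on with
  | zero => simpa using h0
  | of q a =>
    have : h.sumEquiv (DirectSum.of (fun p => 𝒜 p) q a) = summandIncl 𝒜 q a := by
      change DirectSum.toModule ℂ G A (summandIncl 𝒜) (DirectSum.lof ℂ G (fun p => 𝒜 p) q a) = _
      simp
    rw [this]
    exact hincl q a
  | add y z hy hz =>
    rw [map_add]
    exact hadd _ _ hy hz

theorem proj_mul_left (p : G) (x : A) (b : 𝒜 p) :
    h.proj p (summandIncl 𝒜 p b * x) = b * h.proj p x := by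
  refine h.sum_induction (P := fun x => h.proj p (summandIncl 𝒜 p b * x) = b * h.proj p x)
    (by simp) (fun x y hx hy => by rw [mul_add, map_add, hx, hy, map_add, mul_add]) ?_ x
  intro q a
  by_cases e : q = p
  · subst e
    have : summandIncl 𝒜 q b * summandIncl 𝒜 q a = summandIncl 𝒜 q (b * a) := rfl
    rw [this]
    simp [proj_summandIncl]
  · have : summandIncl 𝒜 p b * summandIncl 𝒜 q a = 0 :=
      h.mul_eq_zero p q (fun e' => e e'.symm) _ b.2 _ a.2
    rw [this]
    simp [proj_summandIncl, e]

theorem proj_mul_right (p : G) (x : A) (b : 𝒜 p) :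
    h.proj p (x * summandIncl 𝒜 p b) = h.proj p x * b := by
  refine h.sum_induction (P := fun x => h.proj p (x * summandIncl 𝒜 p b) = h.proj p x * b)
    (by simp) (fun x y hx hy => by rw [add_mul, map_add, hx, hy, map_add, add_mul]) ?_ x
  intro q a
  by_cases e : q = p
  · subst e
    have : summandIncl 𝒜 q a * summandIncl 𝒜 q b = summandIncl 𝒜 q (a * b) := rfl
    rw [this]
    simp [proj_summandIncl]
  · have : summandIncl 𝒜 q a * summandIncl 𝒜 p b = 0 := h.mul_eq_zero q p e _ a.2 _ b.2
    rw [this]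
    simp [proj_summandIncl, e]

/-- The component `m_p` in `M(A_p)` of a multiplier `m` in `M(A)`, that is, the restriction of `m`
to `A_p`. -/
def component (p : G) (m : Mult A) : Mult (𝒜 p) :=
  Mult.compress (summandIncl 𝒜 p) (h.proj p) (h.proj_mul_left p) (h.proj_mul_right p) m

/-- The component `m_{p,q}` in `M(A_p ⊗ A_q)` of a multiplier `m` in `M(A ⊗ A)`, that is, the
restriction of `m` to `A_p ⊗ A_q`. -/
def component₂ (p q : G) (m : Mult (A ⊗[ℂ] A)) : Mult (𝒜 p ⊗[ℂ] 𝒜 q) :=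
  Mult.compress (TensorProduct.map (summandIncl 𝒜 p) (summandIncl 𝒜 q))
    (TensorProduct.map (h.proj p) (h.proj q))
    (by
      intro x y
      induction x using TensorProduct.induction_on with
      | zero => simp
      | add x x' hx hx' => rw [mul_add, map_add, hx, hx', map_add, mul_add]
      | tmul a b =>
        induction y using TensorProduct.induction_on with
        | zero => simp
        | add y y' hy hy' => rw [map_add, add_mul, map_add, hy, hy', add_mul]
        | tmul c d => simp [proj_mul_left])
    (by
      intro x y
      induction x using TensorProduct.induction_on with
      | zero => simp
      | add x x' hx hx' => rw [add_mul, map_add, hx, hx', map_add, add_mul]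
      | tmul a b =>
        induction y using TensorProduct.induction_on with
        | zero => simp
        | add y y' hy hy' => rw [map_add, mul_add, map_add, hy, hy', mul_add]
        | tmul c d => simp [proj_mul_right])
    m

/-- The map `Δ_{p,q} : A_{pq} → M(A_p ⊗ A_q)`. -/
def coprod [Group G] (Δ : A → Mult (A ⊗[ℂ] A)) (p q : G) (a : 𝒜 (p * q)) :
    Mult (𝒜 p ⊗[ℂ] 𝒜 q) :=
  h.component₂ p q (Δ (a : A))

end IsAlgebraDirectSum

end Cograding

end CogradedMHA

end

set_option linter.unusedSectionVars false

noncomputable section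

/-! The modular element comes from the uniqueness of left integrals. For fixed `b` and a functional
`ω`, coassociativity and left invariance make `a ↦ ω((φ ⊗ ι)(Δ(a)(1 ⊗ b)))` left invariant, hence a
multiple of `φ`. So `(φ ⊗ ι)(Δ(a)(1 ⊗ b)) = φ(a) δb`, where `δb` is the value at some `e` with `φ(e)
= 1` (`existsUnique_isModularElement`).

Uniqueness (`LeftInvariant.unique`) needs a right invariant functional. The canonical bijections
give a counit, and left invariance gives the formula `S((ι ⊗ φ)((1 ⊗ x)Δ(b))) = (ι ⊗ φ)(Δ(x)(1 ⊗
b))` for the inverse antipode `S`. Such slices span `A` on both sides, so `S` is bijective; it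
reverses products and coproducts, hence `ψ = φ ∘ S` is right invariant. For left invariant `θ`,
evaluating `(ψ ⊗ θ)(Δ(x)y)` with `y` written through `Δ(p)(1 ⊗ q)` or through `Δ(p)(q ⊗ 1)`
exchanges functionals `θ(· c)` and `ψ(· d)`. Thus `φ'(· t) = φ(· c)` for another left invariant `φ'`
and suitable `t`, `c`, and the formula for `S` turns this into `ψ(t)φ' = ψ(c)φ`.

Group-likeness (`map_modular_P`) is coassociativity with `φ` applied to the first of three legs. In
the graded case the canonical maps restrict to bijections onto `A_p ⊗ A_q`. This forces the
extension of `Δ_{p,q}` to be `D(m)Δ_{p,q}(c)(1 ⊗ b) = Δ_{p,q}(mc)(1 ⊗ b)`, and both component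
formulas become restrictions of global ones. -/

namespace CogradedMHA

/-! ### Slice maps and separation of points in tensor products -/

section TensorSeparation

variable {V W V' : Type*} [AddCommGroup V] [Module ℂ V] [AddCommGroup W] [Module ℂ W]
  [AddCommGroup V'] [Module ℂ V']

/-- The slice map `φ ⊗ ι`. -/
def sliceL (W : Type*) [AddCommGroup W] [Module ℂ W] (φ : V →ₗ[ℂ] ℂ) : V ⊗[ℂ] W →ₗ[ℂ] W :=
  (TensorProduct.lid ℂ W).toLinearMap ∘ₗ φ.rTensor W

/-- The slice map `ι ⊗ φ`. -/
def sliceR (V : Type*) [AddCommGroup V] [Module ℂ V] (φ : W →ₗ[ℂ] ℂ) : V ⊗[ℂ] W →ₗ[ℂ] V :=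
  (TensorProduct.rid ℂ V).toLinearMap ∘ₗ φ.lTensor V

@[simp] theorem sliceL_tmul (φ : V →ₗ[ℂ] ℂ) (v : V) (w : W) :
    sliceL W φ (v ⊗ₜ[ℂ] w) = φ v • w := by simp [sliceL]

@[simp] theorem sliceR_tmul (φ : W →ₗ[ℂ] ℂ) (v : V) (w : W) :
    sliceR V φ (v ⊗ₜ[ℂ] w) = φ w • v := by simp [sliceR]

theorem eq_zero_of_dual {v : V} (h : ∀ ω : V →ₗ[ℂ] ℂ, ω v = 0) : v = 0 :=
  (Module.forall_dual_apply_eq_zero_iff ℂ v).1 h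

/-- The coordinates of `x` with respect to a basis of `W` are its slices by the coordinate
functionals. -/
theorem eq_zero_of_sliceR {x : V ⊗[ℂ] W} (h : ∀ ω : W →ₗ[ℂ] ℂ, sliceR V ω x = 0) : x = 0 := by
  classical
  let b := Module.Basis.ofVectorSpace ℂ W
  have key : ∀ i, (TensorProduct.equivFinsuppOfBasisRight (M := V) b x) i =
      sliceR V (b.coord i) x := by
    intro i
    clear h
    induction x using TensorProduct.induction_on with
    | zero => simp
    | add x y hx hy => simp [hx, hy]
    | tmul v w => simp
  apply (TensorProduct.equivFinsuppOfBasisRight (M := V) b).injective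
  ext i
  rw [map_zero, Finsupp.zero_apply, key, h]

theorem sliceR_comm (φ : V →ₗ[ℂ] ℂ) (x : V ⊗[ℂ] W) :
    sliceR W φ (TensorProduct.comm ℂ V W x) = sliceL W φ x := by
  induction x using TensorProduct.induction_on with
  | zero => simp
  | add x y hx hy => simp [hx, hy]
  | tmul v w => simp

theorem eq_zero_of_sliceL {x : V ⊗[ℂ] W} (h : ∀ ω : V →ₗ[ℂ] ℂ, sliceL W ω x = 0) : x = 0 := by
  apply (TensorProduct.comm ℂ V W).injective
  rw [map_zero]
  exact eq_zero_of_sliceR fun ω => by rw [sliceR_comm, h]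

theorem sliceR_rTensor (φ : W →ₗ[ℂ] ℂ) (f : V →ₗ[ℂ] V') (x : V ⊗[ℂ] W) :
    sliceR V' φ (f.rTensor W x) = f (sliceR V φ x) := by
  induction x using TensorProduct.induction_on with
  | zero => simp
  | add x y hx hy => simp [hx, hy]
  | tmul v w => simp

theorem sliceL_lTensor (φ : W →ₗ[ℂ] ℂ) (f : V →ₗ[ℂ] V') (x : W ⊗[ℂ] V) :
    sliceL V' φ (f.lTensor W x) = f (sliceL V φ x) := by
  induction x using TensorProduct.induction_on with
  | zero => simp
  | add x y hx hy => simp [hx, hy]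
  | tmul v w => simp

theorem sliceR_lTensor (φ : W →ₗ[ℂ] ℂ) (f : V →ₗ[ℂ] W) (x : V' ⊗[ℂ] V) :
    sliceR V' φ (f.lTensor V' x) = sliceR V' (φ ∘ₗ f) x := by
  induction x using TensorProduct.induction_on with
  | zero => simp
  | add x y hx hy => simp [hx, hy]
  | tmul v w => simp

theorem lTensor_sliceR_assoc (φ : V' →ₗ[ℂ] ℂ) (x : (V ⊗[ℂ] W) ⊗[ℂ] V') :
    (sliceR W φ).lTensor V (TensorProduct.assoc ℂ V W V' x) = sliceR (V ⊗[ℂ] W) φ x := by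
  induction x using TensorProduct.induction_on with
  | zero => simp
  | add x y hx hy => simp [hx, hy]
  | tmul y c =>
    induction y using TensorProduct.induction_on with
    | zero => simp
    | add x y hx hy => simp only [TensorProduct.add_tmul, map_add, hx, hy]
    | tmul v w => simp

theorem sliceL_assoc (φ : V →ₗ[ℂ] ℂ) (x : (V ⊗[ℂ] W) ⊗[ℂ] V') :
    sliceL (W ⊗[ℂ] V') φ (TensorProduct.assoc ℂ V W V' x) = (sliceL W φ).rTensor V' x := by
  induction x using TensorProduct.induction_on with
  | zero => simp
  | add x y hx hy => simp [hx, hy]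
  | tmul y c =>
    induction y using TensorProduct.induction_on with
    | zero => simp
    | add x y hx hy => simp only [TensorProduct.add_tmul, map_add, hx, hy]
    | tmul v w => simp [TensorProduct.smul_tmul']

theorem lTensor_sliceL_assoc (φ : W →ₗ[ℂ] ℂ) (x : (V ⊗[ℂ] W) ⊗[ℂ] V') :
    (sliceL V' φ).lTensor V (TensorProduct.assoc ℂ V W V' x) = (sliceR V φ).rTensor V' x := by
  induction x using TensorProduct.induction_on with
  | zero => simp
  | add x y hx hy => simp [hx, hy]
  | tmul y c =>
    induction y using TensorProduct.induction_on with
    | zero => simp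
    | add x y hx hy => simp only [TensorProduct.add_tmul, map_add, hx, hy]
    | tmul v w => simp [TensorProduct.smul_tmul]

/-- A jointly injective family of linear maps stays so after tensoring on the right. -/
theorem rTensor_jointly_injective {ι : Sort*} (f : ι → V →ₗ[ℂ] V')
    (hf : ∀ v, (∀ i, f i v = 0) → v = 0) {x y : V ⊗[ℂ] W}
    (h : ∀ i, (f i).rTensor W x = (f i).rTensor W y) : x = y := by
  rw [← sub_eq_zero]
  refine eq_zero_of_sliceR fun ω => hf _ fun i => ?_
  rw [← sliceR_rTensor, map_sub, h, sub_self, map_zero]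

/-- A jointly injective family of linear maps stays so after tensoring on the left. -/
theorem lTensor_jointly_injective {ι : Sort*} (f : ι → V →ₗ[ℂ] V')
    (hf : ∀ v, (∀ i, f i v = 0) → v = 0) {x y : W ⊗[ℂ] V}
    (h : ∀ i, (f i).lTensor W x = (f i).lTensor W y) : x = y := by
  rw [← sub_eq_zero]
  refine eq_zero_of_sliceL fun ω => hf _ fun i => ?_
  rw [← sliceL_lTensor, map_sub, h, sub_self, map_zero]

end TensorSeparation

/-! ### Multipliers and non-degenerate products -/

section MultiplierLemmas

variable {A : Type*} [NonUnitalRing A] [Module ℂ A] [SMulCommClass ℂ A A] [IsScalarTower ℂ A A]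
variable {B : Type*} [NonUnitalRing B] [Module ℂ B] [SMulCommClass ℂ B B] [IsScalarTower ℂ B B]

namespace NondegenerateProduct

theorem ext_left (hA : NondegenerateProduct A) {x y : A} (h : ∀ a, a * x = a * y) : x = y := by
  rw [← sub_eq_zero]
  exact hA.2 _ fun a => by rw [mul_sub, h, sub_self]

theorem ext_right (hA : NondegenerateProduct A) {x y : A} (h : ∀ a, x * a = y * a) : x = y := by
  rw [← sub_eq_zero]
  exact hA.1 _ fun a => by rw [sub_mul, h, sub_self]

end NondegenerateProduct

variable (B) in
/-- Multiplication by `a ⊗ 1` from the left. -/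
def l1 (a : A) : A ⊗[ℂ] B →ₗ[ℂ] A ⊗[ℂ] B := (LinearMap.mulLeft ℂ a).rTensor B

variable (B) in
/-- Multiplication by `a ⊗ 1` from the right. -/
def r1 (a : A) : A ⊗[ℂ] B →ₗ[ℂ] A ⊗[ℂ] B := (LinearMap.mulRight ℂ a).rTensor B

variable (A) in
/-- Multiplication by `1 ⊗ b` from the left. -/
def l2 (b : B) : A ⊗[ℂ] B →ₗ[ℂ] A ⊗[ℂ] B := (LinearMap.mulLeft ℂ b).lTensor A

variable (A) in
/-- Multiplication by `1 ⊗ b` from the right. -/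
def r2 (b : B) : A ⊗[ℂ] B →ₗ[ℂ] A ⊗[ℂ] B := (LinearMap.mulRight ℂ b).lTensor A

@[simp] theorem l1_tmul (a x : A) (y : B) : l1 B a (x ⊗ₜ[ℂ] y) = (a * x) ⊗ₜ y := by simp [l1]
@[simp] theorem r1_tmul (a x : A) (y : B) : r1 B a (x ⊗ₜ[ℂ] y) = (x * a) ⊗ₜ y := by simp [r1]
@[simp] theorem l2_tmul (b : B) (x : A) (y : B) : l2 A b (x ⊗ₜ[ℂ] y) = x ⊗ₜ (b * y) := by simp [l2]
@[simp] theorem r2_tmul (b : B) (x : A) (y : B) : r2 A b (x ⊗ₜ[ℂ] y) = x ⊗ₜ (y * b) := by simp [r2]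

theorem ext_l1 (hA : NondegenerateProduct A) {W : Type*} [AddCommGroup W] [Module ℂ W]
    {x y : A ⊗[ℂ] W} (h : ∀ a : A, (LinearMap.mulLeft ℂ a).rTensor W x =
      (LinearMap.mulLeft ℂ a).rTensor W y) : x = y :=
  rTensor_jointly_injective _ (fun v hv => hA.2 v hv) h

theorem ext_r1 (hA : NondegenerateProduct A) {x y : A ⊗[ℂ] B} (h : ∀ a, r1 B a x = r1 B a y) :
    x = y :=
  rTensor_jointly_injective _ (fun v hv => hA.1 v hv) h

theorem ext_l2 (hB : NondegenerateProduct B) {x y : A ⊗[ℂ] B} (h : ∀ b, l2 A b x = l2 A b y) :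
    x = y :=
  lTensor_jointly_injective _ (fun v hv => hB.2 v hv) h

theorem ext_r2 (hB : NondegenerateProduct B) {x y : A ⊗[ℂ] B} (h : ∀ b, r2 A b x = r2 A b y) :
    x = y :=
  lTensor_jointly_injective _ (fun v hv => hB.1 v hv) h

theorem mul_tmul_eq (x : A ⊗[ℂ] B) (a : A) (b : B) : x * (a ⊗ₜ[ℂ] b) = r1 B a (r2 A b x) := by
  induction x using TensorProduct.induction_on with
  | zero => simp
  | add x y hx hy => simp [add_mul, hx, hy]
  | tmul v w => simp

theorem tmul_mul_eq (x : A ⊗[ℂ] B) (a : A) (b : B) : (a ⊗ₜ[ℂ] b) * x = l1 B a (l2 A b x) := by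
  induction x using TensorProduct.induction_on with
  | zero => simp
  | add x y hx hy => rw [mul_add, hx, hy, map_add, map_add]
  | tmul v w => simp

/-- The tensor product of algebras with non-degenerate product has non-degenerate product. -/
theorem NondegenerateProduct.tensor (hA : NondegenerateProduct A) (hB : NondegenerateProduct B) :
    NondegenerateProduct (A ⊗[ℂ] B) := by
  constructor
  · intro x hx
    refine ext_r2 hB fun b => ext_r1 hA fun a => ?_
    rw [← mul_tmul_eq, hx, map_zero, map_zero]
  · intro x hx
    refine ext_l2 hB fun b => ext_l1 hA fun a => ?_
    have := hx (a ⊗ₜ b)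
    rw [tmul_mul_eq] at this
    rw [map_zero, map_zero]
    exact this

namespace Mult

theorem ext' {m n : Mult A} (hl : ∀ a, m.left a = n.left a) (hr : ∀ a, m.right a = n.right a) :
    m = n := by
  apply Subtype.ext
  apply Prod.ext
  · exact LinearMap.ext hl
  · exact MulOpposite.unop_injective (LinearMap.ext hr)

/-- A multiplier is determined by its left action. -/
theorem ext_left (hA : NondegenerateProduct A) {m n : Mult A} (h : ∀ a, m.left a = n.left a) :
    m = n :=
  ext' h fun a => hA.ext_right fun b => by rw [central, central, h]

/-- A multiplier is determined by its right action. -/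
theorem ext_right (hA : NondegenerateProduct A) {m n : Mult A} (h : ∀ a, m.right a = n.right a) :
    m = n :=
  ext' (fun a => hA.ext_left fun b => by rw [← central, ← central, h]) h

@[simp] theorem left_mul (m n : Mult A) (a : A) : (m * n).left a = m.left (n.left a) := rfl
@[simp] theorem right_mul (m n : Mult A) (a : A) : (m * n).right a = n.right (m.right a) := rfl
@[simp] theorem left_add (m n : Mult A) (a : A) : (m + n).left a = m.left a + n.left a := rfl
@[simp] theorem right_add (m n : Mult A) (a : A) : (m + n).right a = m.right a + n.right a := rfl
@[simp] theorem left_smul (r : ℂ) (m : Mult A) (a : A) : (r • m).left a = r • m.left a := rfl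
@[simp] theorem right_smul (r : ℂ) (m : Mult A) (a : A) : (r • m).right a = r • m.right a := rfl
@[simp] theorem left_one (a : A) : (1 : Mult A).left a = a := rfl
@[simp] theorem left_zero (a : A) : (0 : Mult A).left a = 0 := rfl
@[simp] theorem left_mk (L R : A →ₗ[ℂ] A) (h) : (mk L R h).left = L := rfl
@[simp] theorem right_mk (L R : A →ₗ[ℂ] A) (h) : (mk L R h).right = R := rfl
@[simp] theorem left_incl (a b : A) : (incl a).left b = a * b := rfl
@[simp] theorem right_incl (a b : A) : (incl a).right b = b * a := rfl
theorem left_tmul (m : Mult A) (n : Mult B) :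
    (tmul m n).left = TensorProduct.map m.left n.left := rfl
theorem right_tmul (m : Mult A) (n : Mult B) :
    (tmul m n).right = TensorProduct.map m.right n.right := rfl

theorem left_apply_mul (hA : NondegenerateProduct A) (m : Mult A) (a b : A) :
    m.left (a * b) = m.left a * b :=
  hA.ext_left fun c => by rw [← central, ← mul_assoc, central, mul_assoc]

theorem right_apply_mul (hA : NondegenerateProduct A) (m : Mult A) (a b : A) :
    m.right (a * b) = a * m.right b :=
  hA.ext_right fun c => by rw [central, mul_assoc, ← central, ← mul_assoc]

theorem incl_injective (hA : NondegenerateProduct A) : Function.Injective (incl : A → Mult A) := by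
  intro a b h
  refine hA.ext_right fun c => ?_
  rw [← left_incl, ← left_incl, h]

theorem incl_left (hA : NondegenerateProduct A) (m : Mult A) (a : A) :
    incl (m.left a) = m * incl a :=
  ext_left hA fun b => by simp [left_apply_mul hA]

theorem incl_right (hA : NondegenerateProduct A) (m : Mult A) (a : A) :
    incl (m.right a) = incl a * m :=
  ext_right hA fun b => by simp [right_apply_mul hA]

theorem incl_add (a b : A) : incl (a + b) = incl a + incl b :=
  ext' (fun c => by simp [add_mul]) fun c => by simp [mul_add]

theorem incl_smul (r : ℂ) (a : A) : incl (r • a) = r • incl a :=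
  ext' (fun c => by simp [smul_mul_assoc]) fun c => by simp [mul_smul_comm]

theorem incl_mul (a b : A) : incl (a * b) = incl a * incl b :=
  ext' (fun c => by simp [mul_assoc]) fun c => by simp [mul_assoc]

theorem tmul_mul (m m' : Mult A) (n n' : Mult B) :
    tmul (m * m') (n * n') = tmul m n * tmul m' n' := by
  apply ext'
  · intro x
    simp only [left_mul, left_tmul]
    rw [← LinearMap.comp_apply, ← TensorProduct.map_comp]
    rfl
  · intro x
    simp only [right_mul, right_tmul]
    rw [← LinearMap.comp_apply, ← TensorProduct.map_comp]
    rfl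

/-- `m ⊗ 1` and `1 ⊗ n` commute. -/
theorem tmul_one_comm (m : Mult A) (n : Mult B) :
    tmul m 1 * tmul 1 n = tmul 1 n * tmul m 1 := by
  rw [← tmul_mul, ← tmul_mul, one_mul, one_mul, mul_one, mul_one]

theorem incl_tmul (a : A) (b : B) : incl (a ⊗ₜ[ℂ] b) = tmul (incl a) (incl b) := by
  apply ext'
  · intro x
    induction x using TensorProduct.induction_on with
    | zero => simp
    | add x y hx hy => rw [map_add, hx, hy, map_add]
    | tmul v w => simp [left_tmul]
  · intro x
    induction x using TensorProduct.induction_on with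
    | zero => simp
    | add x y hx hy => rw [map_add, hx, hy, map_add]
    | tmul v w => simp [right_tmul]

theorem incl_l1 (hAB : NondegenerateProduct (A ⊗[ℂ] B)) (a : A) (x : A ⊗[ℂ] B) :
    incl (l1 B a x) = tmul (incl a) 1 * incl x :=
  incl_left hAB (tmul (incl a) 1) x

theorem incl_r1 (hAB : NondegenerateProduct (A ⊗[ℂ] B)) (a : A) (x : A ⊗[ℂ] B) :
    incl (r1 B a x) = incl x * tmul (incl a) 1 :=
  incl_right hAB (tmul (incl a) 1) x

theorem incl_l2 (hAB : NondegenerateProduct (A ⊗[ℂ] B)) (b : B) (x : A ⊗[ℂ] B) :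
    incl (l2 A b x) = tmul 1 (incl b) * incl x :=
  incl_left hAB (tmul 1 (incl b)) x

theorem incl_r2 (hAB : NondegenerateProduct (A ⊗[ℂ] B)) (b : B) (x : A ⊗[ℂ] B) :
    incl (r2 A b x) = incl x * tmul 1 (incl b) :=
  incl_right hAB (tmul 1 (incl b)) x

end Mult

end MultiplierLemmas

/-! ### Canonical maps of a regular multiplier Hopf algebra and coassociativity -/

section CoverMaps

variable {A : Type*} [NonUnitalRing A] [Module ℂ A] [SMulCommClass ℂ A A] [IsScalarTower ℂ A A]

/-- The four canonical bijections of a regular multiplier Hopf algebra, together with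
coassociativity: `TP (c ⊗ b) = Δ(b)(1 ⊗ c)`, `TQ (a ⊗ b) = (a ⊗ 1)Δ(b)`,
`TR (c ⊗ b) = Δ(b)(c ⊗ 1)` and `TL (a ⊗ b) = (1 ⊗ a)Δ(b)`. -/
structure CoverMaps (Δ : A → Mult (A ⊗[ℂ] A)) where
  nondeg : NondegenerateProduct A
  Δ_add : ∀ a b, Δ (a + b) = Δ a + Δ b
  Δ_smul : ∀ (r : ℂ) a, Δ (r • a) = r • Δ a
  Δ_mul : ∀ a b, Δ (a * b) = Δ a * Δ b
  TP : A ⊗[ℂ] A ≃ₗ[ℂ] A ⊗[ℂ] A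
  TQ : A ⊗[ℂ] A ≃ₗ[ℂ] A ⊗[ℂ] A
  TR : A ⊗[ℂ] A ≃ₗ[ℂ] A ⊗[ℂ] A
  TL : A ⊗[ℂ] A ≃ₗ[ℂ] A ⊗[ℂ] A
  incl_TP : ∀ c b, Mult.incl (TP (c ⊗ₜ b)) = Δ b * Mult.tmul 1 (Mult.incl c)
  incl_TQ : ∀ a b, Mult.incl (TQ (a ⊗ₜ b)) = Mult.tmul (Mult.incl a) 1 * Δ b
  incl_TR : ∀ c b, Mult.incl (TR (c ⊗ₜ b)) = Δ b * Mult.tmul (Mult.incl c) 1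
  incl_TL : ∀ a b, Mult.incl (TL (a ⊗ₜ b)) = Mult.tmul 1 (Mult.incl a) * Δ b
  coassocPQ : ∀ a b c,
    (TP.toLinearMap ∘ₗ TensorProduct.mk ℂ A A c).lTensor A (TQ (a ⊗ₜ b)) =
      TensorProduct.assoc ℂ A A A
        ((TQ.toLinearMap ∘ₗ TensorProduct.mk ℂ A A a).rTensor A (TP (c ⊗ₜ b)))
  coassocLR : ∀ a b c,
    (TL.toLinearMap ∘ₗ TensorProduct.mk ℂ A A c).lTensor A (TR (a ⊗ₜ b)) =
      TensorProduct.assoc ℂ A A A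
        ((TR.toLinearMap ∘ₗ TensorProduct.mk ℂ A A a).rTensor A (TL (c ⊗ₜ b)))

namespace Mult

theorem flip_flip (m : Mult (A ⊗[ℂ] A)) : flip (flip m) = m := by
  have h : ∀ z : A ⊗[ℂ] A, TensorProduct.comm ℂ A A (TensorProduct.comm ℂ A A z) = z :=
    fun z => (TensorProduct.comm ℂ A A).symm_apply_apply z
  exact ext' (fun x => by simp [flip, h]) (fun x => by simp [flip, h])

theorem flip_mul (m n : Mult (A ⊗[ℂ] A)) : flip (m * n) = flip m * flip n := by
  have h : ∀ z : A ⊗[ℂ] A, TensorProduct.comm ℂ A A (TensorProduct.comm ℂ A A z) = z :=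
    fun z => (TensorProduct.comm ℂ A A).symm_apply_apply z
  exact ext' (fun x => by simp [flip, h]) (fun x => by simp [flip, h])

theorem flip_tmul (m n : Mult A) : flip (tmul m n) = tmul n m := by
  apply ext'
  · intro x
    induction x using TensorProduct.induction_on with
    | zero => simp
    | add x y hx hy => rw [map_add, hx, hy, map_add]
    | tmul v w => simp [flip, tmul]
  · intro x
    induction x using TensorProduct.induction_on with
    | zero => simp
    | add x y hx hy => rw [map_add, hx, hy, map_add]
    | tmul v w => simp [flip, tmul]

theorem incl_comm (x : A ⊗[ℂ] A) : incl (TensorProduct.comm ℂ A A x) = flip (incl x) := by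
  have h : ∀ z : A ⊗[ℂ] A, TensorProduct.comm ℂ A A (TensorProduct.comm ℂ A A z) = z :=
    fun z => (TensorProduct.comm ℂ A A).symm_apply_apply z
  exact ext' (fun y => by simp [flip, comm_mul, h]) (fun y => by simp [flip, comm_mul, h])

end Mult

/-- The reversal `a ⊗ b ⊗ c ↦ c ⊗ b ⊗ a` of the tensor legs. -/
def reverse (A : Type*) [AddCommGroup A] [Module ℂ A] :
    (A ⊗[ℂ] A) ⊗[ℂ] A →ₗ[ℂ] A ⊗[ℂ] (A ⊗[ℂ] A) :=
  (TensorProduct.comm ℂ A A).toLinearMap.lTensor A ∘ₗ (TensorProduct.comm ℂ (A ⊗[ℂ] A) A).toLinearMap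

/-- With `reverse_lTensor`, this translates coassociativity of `Δᵒᵖ` into coassociativity of `Δ`
covered from the opposite sides. -/
theorem reverse_rTensor (f : A →ₗ[ℂ] A ⊗[ℂ] A) (x : A ⊗[ℂ] A) :
    reverse A (((TensorProduct.comm ℂ A A).toLinearMap ∘ₗ f).rTensor A
      (TensorProduct.comm ℂ A A x)) = f.lTensor A x := by
  have h : ∀ z : A ⊗[ℂ] A, TensorProduct.comm ℂ A A (TensorProduct.comm ℂ A A z) = z :=
    fun z => (TensorProduct.comm ℂ A A).symm_apply_apply z
  induction x using TensorProduct.induction_on with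
  | zero => simp
  | add x y hx hy => simp only [map_add, hx, hy]
  | tmul v w => simp [reverse, h]

theorem reverse_lTensor (f : A →ₗ[ℂ] A ⊗[ℂ] A) (x : A ⊗[ℂ] A) :
    reverse A ((TensorProduct.assoc ℂ A A A).symm
      (((TensorProduct.comm ℂ A A).toLinearMap ∘ₗ f).lTensor A
      (TensorProduct.comm ℂ A A x))) = TensorProduct.assoc ℂ A A A (f.rTensor A x) := by
  induction x using TensorProduct.induction_on with
  | zero => simp
  | add x y hx hy => simp only [map_add, hx, hy]
  | tmul v w =>
    simp only [TensorProduct.comm_tmul, LinearMap.lTensor_tmul, LinearMap.comp_apply,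
      LinearMap.rTensor_tmul, LinearEquiv.coe_coe]
    generalize f v = z
    induction z using TensorProduct.induction_on with
    | zero => simp
    | add x y hx hy => simp only [map_add, TensorProduct.tmul_add, TensorProduct.add_tmul, hx, hy]
    | tmul v w => simp [reverse]

theorem rTensor_assoc_symm_tmul (T : A ⊗[ℂ] A →ₗ[ℂ] A ⊗[ℂ] A) (a : A) (z : A ⊗[ℂ] A) :
    T.rTensor A ((TensorProduct.assoc ℂ A A A).symm (a ⊗ₜ z)) =
      (T ∘ₗ TensorProduct.mk ℂ A A a).rTensor A z := by
  induction z using TensorProduct.induction_on with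
  | zero => simp
  | add x y hx hy => simp only [map_add, TensorProduct.tmul_add, hx, hy]
  | tmul v w => simp

theorem lTensor_assoc_tmul (T : A ⊗[ℂ] A →ₗ[ℂ] A ⊗[ℂ] A) (c : A) (z : A ⊗[ℂ] A) :
    T.lTensor A (TensorProduct.assoc ℂ A A A (z ⊗ₜ c)) =
      (T ∘ₗ (TensorProduct.mk ℂ A A).flip c).lTensor A z := by
  induction z using TensorProduct.induction_on with
  | zero => simp
  | add x y hx hy => simp only [map_add, TensorProduct.add_tmul, hx, hy]
  | tmul v w => simp

/-- `TP` and `TQ` are the canonical maps of `Δ`; `TR` and `TL` are those of `Δᵒᵖ`, transported by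
the flip. -/
theorem IsRegularMultiplierHopfAlgebra.nonempty_coverMaps {Δ : A → Mult (A ⊗[ℂ] A)}
    (h : IsRegularMultiplierHopfAlgebra Δ) : Nonempty (CoverMaps Δ) := by
  obtain ⟨⟨hA, ⟨hadd, hsmul, hmul⟩, T₁, T₂, h₁, h₂, hc⟩, -, -, U₁, U₂, k₁, k₂, kc⟩ := h
  have hAA := hA.tensor hA
  let κ := TensorProduct.comm ℂ A A
  have hκ : ∀ z, κ (κ z) = z := fun z => κ.symm_apply_apply z
  refine ⟨⟨hA, hadd, hsmul, hmul, κ.trans T₁, T₂, κ.trans (U₁.trans κ), U₂.trans κ, ?_, ?_, ?_, ?_, ?_, ?_⟩⟩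
  · intro c b
    exact h₁ b c
  · exact h₂
  · intro c b
    change Mult.incl (κ (U₁ (b ⊗ₜ c))) = _
    rw [Mult.incl_comm, k₁, Mult.flip_mul, Mult.flip_flip, Mult.flip_tmul]
  · intro a b
    change Mult.incl (κ (U₂ (a ⊗ₜ b))) = _
    rw [Mult.incl_comm, k₂, Mult.flip_mul, Mult.flip_flip, Mult.flip_tmul]
  · intro a b c
    have := hc a b c
    rw [rTensor_assoc_symm_tmul, lTensor_assoc_tmul, LinearEquiv.eq_symm_apply] at this
    exact this.symm
  · intro a b c
    have := kc c b a
    rw [rTensor_assoc_symm_tmul, lTensor_assoc_tmul] at this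
    have e₁ : U₂.toLinearMap ∘ₗ TensorProduct.mk ℂ A A c =
        κ.toLinearMap ∘ₗ ((U₂.trans κ).toLinearMap ∘ₗ TensorProduct.mk ℂ A A c) := by
      ext x; exact (hκ _).symm
    have e₂ : U₁.toLinearMap ∘ₗ (TensorProduct.mk ℂ A A).flip a =
        κ.toLinearMap ∘ₗ ((κ.trans (U₁.trans κ)).toLinearMap ∘ₗ TensorProduct.mk ℂ A A a) := by
      ext x; exact (hκ _).symm
    have e₃ : U₁ (b ⊗ₜ a) = κ ((κ.trans (U₁.trans κ)) (a ⊗ₜ b)) := (hκ _).symm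
    have e₄ : U₂ (c ⊗ₜ b) = κ ((U₂.trans κ) (c ⊗ₜ b)) := (hκ _).symm
    rw [e₁, e₂, e₃, e₄] at this
    rw [← reverse_rTensor, this, reverse_lTensor]

namespace CoverMaps

variable {Δ : A → Mult (A ⊗[ℂ] A)} (H : CoverMaps Δ)

/-- `P c b = Δ(b)(1 ⊗ c)`. -/
def P (c : A) : A →ₗ[ℂ] A ⊗[ℂ] A := H.TP.toLinearMap ∘ₗ TensorProduct.mk ℂ A A c
/-- `Q a b = (a ⊗ 1)Δ(b)`. -/
def Q (a : A) : A →ₗ[ℂ] A ⊗[ℂ] A := H.TQ.toLinearMap ∘ₗ TensorProduct.mk ℂ A A a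
/-- `R c b = Δ(b)(c ⊗ 1)`. -/
def R (c : A) : A →ₗ[ℂ] A ⊗[ℂ] A := H.TR.toLinearMap ∘ₗ TensorProduct.mk ℂ A A c
/-- `L a b = (1 ⊗ a)Δ(b)`. -/
def L (a : A) : A →ₗ[ℂ] A ⊗[ℂ] A := H.TL.toLinearMap ∘ₗ TensorProduct.mk ℂ A A a

theorem TP_tmul (c b : A) : H.TP (c ⊗ₜ b) = H.P c b := rfl
theorem TQ_tmul (a b : A) : H.TQ (a ⊗ₜ b) = H.Q a b := rfl
theorem TR_tmul (c b : A) : H.TR (c ⊗ₜ b) = H.R c b := rfl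

theorem nondeg₂ (H : CoverMaps Δ) : NondegenerateProduct (A ⊗[ℂ] A) := H.nondeg.tensor H.nondeg

theorem incl_P (c b : A) : Mult.incl (H.P c b) = Δ b * Mult.tmul 1 (Mult.incl c) := H.incl_TP c b
theorem incl_Q (a b : A) : Mult.incl (H.Q a b) = Mult.tmul (Mult.incl a) 1 * Δ b := H.incl_TQ a b
theorem incl_R (c b : A) : Mult.incl (H.R c b) = Δ b * Mult.tmul (Mult.incl c) 1 := H.incl_TR c b
theorem incl_L (a b : A) : Mult.incl (H.L a b) = Mult.tmul 1 (Mult.incl a) * Δ b := H.incl_TL a b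

theorem l1_P (e c b : A) : l1 A e (H.P c b) = r2 A c (H.Q e b) := by
  apply Mult.incl_injective H.nondeg₂
  rw [Mult.incl_l1 H.nondeg₂, Mult.incl_r2 H.nondeg₂, incl_P, incl_Q, mul_assoc]

theorem l1_R (e c b : A) : l1 A e (H.R c b) = r1 A c (H.Q e b) := by
  apply Mult.incl_injective H.nondeg₂
  rw [Mult.incl_l1 H.nondeg₂, Mult.incl_r1 H.nondeg₂, incl_R, incl_Q, mul_assoc]

theorem l2_P (e c b : A) : l2 A e (H.P c b) = r2 A c (H.L e b) := by
  apply Mult.incl_injective H.nondeg₂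
  rw [Mult.incl_l2 H.nondeg₂, Mult.incl_r2 H.nondeg₂, incl_P, incl_L, mul_assoc]

theorem r1_P (a c b : A) : r1 A a (H.P c b) = r2 A c (H.R a b) := by
  apply Mult.incl_injective H.nondeg₂
  rw [Mult.incl_r1 H.nondeg₂, Mult.incl_r2 H.nondeg₂, incl_P, incl_R, mul_assoc, mul_assoc,
    Mult.tmul_one_comm]

theorem l1_L (f x b : A) : l1 A f (H.L x b) = l2 A x (H.Q f b) := by
  apply Mult.incl_injective H.nondeg₂
  rw [Mult.incl_l1 H.nondeg₂, Mult.incl_l2 H.nondeg₂, incl_L, incl_Q, ← mul_assoc, ← mul_assoc,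
    Mult.tmul_one_comm]

theorem left_P (a c b : A) : (Δ a).left (H.P c b) = H.P c (a * b) := by
  apply Mult.incl_injective H.nondeg₂
  rw [Mult.incl_left H.nondeg₂, incl_P, incl_P, H.Δ_mul, mul_assoc]

theorem left_R (a c b : A) : (Δ a).left (H.R c b) = H.R c (a * b) := by
  apply Mult.incl_injective H.nondeg₂
  rw [Mult.incl_left H.nondeg₂, incl_R, incl_R, H.Δ_mul, mul_assoc]

theorem right_Q (a c b : A) : (Δ a).right (H.Q c b) = H.Q c (b * a) := by
  apply Mult.incl_injective H.nondeg₂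
  rw [Mult.incl_right H.nondeg₂, incl_Q, incl_Q, H.Δ_mul, mul_assoc]

theorem left_tmul_P (x a b : A) : (Δ x).left (a ⊗ₜ b) = r1 A a (H.P b x) := by
  apply Mult.incl_injective H.nondeg₂
  rw [Mult.incl_left H.nondeg₂, Mult.incl_r1 H.nondeg₂, incl_P, Mult.incl_tmul, mul_assoc,
    ← Mult.tmul_mul, one_mul, mul_one]

theorem left_tmul_R (x a b : A) : (Δ x).left (a ⊗ₜ b) = r2 A b (H.R a x) := by
  rw [left_tmul_P, r1_P]

theorem right_tmul_L (x a b : A) : (Δ x).right (a ⊗ₜ b) = l1 A a (H.L b x) := by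
  apply Mult.incl_injective H.nondeg₂
  rw [Mult.incl_right H.nondeg₂, Mult.incl_l1 H.nondeg₂, incl_L, Mult.incl_tmul, ← mul_assoc,
    ← Mult.tmul_mul, one_mul, mul_one]

/-- As `Δ` is multiplicative, the canonical maps carry multiplication by `Δ(x)` to multiplication on
the second leg. After an integral has absorbed the canonical map, only that multiplication remains.
-/
theorem left_TR (x : A) (z : A ⊗[ℂ] A) : (Δ x).left (H.TR z) = H.TR (l2 A x z) := by
  induction z using TensorProduct.induction_on with
  | zero => simp
  | add x y hx hy => simp only [map_add, hx, hy]
  | tmul v w => rw [l2_tmul, TR_tmul, TR_tmul, left_R]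

theorem right_TQ (x : A) (z : A ⊗[ℂ] A) : (Δ x).right (H.TQ z) = H.TQ (r2 A x z) := by
  induction z using TensorProduct.induction_on with
  | zero => simp
  | add x y hx hy => simp only [map_add, hx, hy]
  | tmul v w => rw [r2_tmul, TQ_tmul, TQ_tmul, right_Q]

theorem left_TP (x : A) (z : A ⊗[ℂ] A) : (Δ x).left (H.TP z) = H.TP (l2 A x z) := by
  induction z using TensorProduct.induction_on with
  | zero => simp
  | add x y hx hy => simp only [map_add, hx, hy]
  | tmul v w => rw [l2_tmul, TP_tmul, TP_tmul, left_P]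

theorem coassoc_PQ (a b c : A) : (H.P c).lTensor A (H.Q a b) =
    TensorProduct.assoc ℂ A A A ((H.Q a).rTensor A (H.P c b)) := H.coassocPQ a b c

theorem coassoc_LR (a b c : A) : (H.L c).lTensor A (H.R a b) =
    TensorProduct.assoc ℂ A A A ((H.R a).rTensor A (H.L c b)) := H.coassocLR a b c

section Auxiliary

variable {V W : Type*} [AddCommGroup V] [Module ℂ V] [AddCommGroup W] [Module ℂ W]

theorem rTensor_assoc (f : A →ₗ[ℂ] A) (x : (A ⊗[ℂ] V) ⊗[ℂ] W) :
    f.rTensor (V ⊗[ℂ] W) (TensorProduct.assoc ℂ A V W x) =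
      TensorProduct.assoc ℂ A V W ((f.rTensor V).rTensor W x) := by
  induction x using TensorProduct.induction_on with
  | zero => simp
  | add x y hx hy => simp only [map_add, hx, hy]
  | tmul y c =>
    induction y using TensorProduct.induction_on with
    | zero => simp
    | add x y hx hy => simp only [TensorProduct.add_tmul, map_add, hx, hy]
    | tmul v w => simp

theorem rTensor_lTensor (f : A →ₗ[ℂ] A) (g : V →ₗ[ℂ] W) (x : A ⊗[ℂ] V) :
    f.rTensor W (g.lTensor A x) = g.lTensor A (f.rTensor V x) := by
  rw [← LinearMap.comp_apply, ← LinearMap.comp_apply, LinearMap.rTensor_comp_lTensor,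
    LinearMap.lTensor_comp_rTensor]

end Auxiliary

/-- Multiplying the first leg by `e` from the left turns `R` into `Q`, so that `coassoc_PQ` applies;
non-degeneracy removes `e`. -/
theorem coassoc_PR (a b c : A) : (H.P c).lTensor A (H.R a b) =
    TensorProduct.assoc ℂ A A A ((H.R a).rTensor A (H.P c b)) := by
  refine ext_l1 H.nondeg fun e => ?_
  rw [rTensor_lTensor, rTensor_assoc]
  change (H.P c).lTensor A (l1 A e (H.R a b)) = _
  rw [l1_R, r1, ← rTensor_lTensor, coassoc_PQ, rTensor_assoc]
  congr 1
  rw [← LinearMap.rTensor_comp_apply, ← LinearMap.rTensor_comp_apply]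
  congr 2
  ext x
  exact (H.l1_R e a x).symm

/-- Multiplying the first leg by `e` from the right turns `Q` into `R`, so that `coassoc_LR`
applies; non-degeneracy removes `e`. -/
theorem coassoc_LQ (a b c : A) : (H.L c).lTensor A (H.Q a b) =
    TensorProduct.assoc ℂ A A A ((H.Q a).rTensor A (H.L c b)) := by
  refine rTensor_jointly_injective (fun e => LinearMap.mulRight ℂ e) (fun v hv => H.nondeg.1 v hv)
    fun e => ?_
  rw [rTensor_lTensor, rTensor_assoc]
  change (H.L c).lTensor A (r1 A e (H.Q a b)) = _
  rw [← l1_R, l1, ← rTensor_lTensor, coassoc_LR, rTensor_assoc]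
  congr 1
  rw [← LinearMap.rTensor_comp_apply, ← LinearMap.rTensor_comp_apply]
  congr 2
  ext x
  exact H.l1_R a e x

/-- `(Δ ⊗ ι)(Δ(e)(1 ⊗ v))(1 ⊗ u ⊗ 1)`, as a function of `u ⊗ v`. -/
def iterated (e : A) : A ⊗[ℂ] A →ₗ[ℂ] A ⊗[ℂ] (A ⊗[ℂ] A) :=
  TensorProduct.lift (LinearMap.mk₂ ℂ
    (fun u v => TensorProduct.assoc ℂ A A A ((H.P u).rTensor A (H.P v e)))
    (fun u u' v => by
      have : H.P (u + u') = H.P u + H.P u' := by simp [P, LinearMap.comp_add]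
      simp [this, LinearMap.rTensor_add])
    (fun r u v => by
      have : H.P (r • u) = r • H.P u := by simp [P, LinearMap.comp_smul]
      simp [this, LinearMap.rTensor_smul])
    (fun u v v' => by simp [← TP_tmul, TensorProduct.add_tmul])
    (fun r u v => by simp [← TP_tmul, ← TensorProduct.smul_tmul']))

theorem iterated_tmul (e u v : A) : H.iterated e (u ⊗ₜ v) =
    TensorProduct.assoc ℂ A A A ((H.P u).rTensor A (H.P v e)) := by
  rw [iterated, TensorProduct.lift.tmul]
  rfl

/-- `h ↦ Δ(h)z`. -/
def leftAct (z : A ⊗[ℂ] A) : A →ₗ[ℂ] A ⊗[ℂ] A where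
  toFun h := (Δ h).left z
  map_add' x y := by rw [H.Δ_add, Mult.left_add]
  map_smul' r x := by rw [H.Δ_smul, Mult.left_smul]; rfl

theorem assoc_rTensor_r2 (u : A) (x : (A ⊗[ℂ] A) ⊗[ℂ] A) :
    TensorProduct.assoc ℂ A A A ((r2 A u).rTensor A x) =
      (r1 A u).lTensor A (TensorProduct.assoc ℂ A A A x) := by
  induction x using TensorProduct.induction_on with
  | zero => simp
  | add x y hx hy => simp only [map_add, hx, hy]
  | tmul y c =>
    induction y using TensorProduct.induction_on with
    | zero => simp
    | add x y hx hy => simp only [TensorProduct.add_tmul, map_add, hx, hy]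
    | tmul v w => simp

/-- This is coassociativity with the last two legs multiplied by an arbitrary `z` in place of an
elementary tensor, which allows `z` to be a coproduct. -/
theorem rTensor_iterated (c e : A) (z : A ⊗[ℂ] A) :
    (LinearMap.mulLeft ℂ c).rTensor (A ⊗[ℂ] A) (H.iterated e z) =
      (H.leftAct z).lTensor A (H.Q c e) := by
  induction z using TensorProduct.induction_on with
  | zero =>
    have : H.leftAct 0 = 0 := by ext x; simp [leftAct]
    simp [this]
  | add x y hx hy =>
    have : H.leftAct (x + y) = H.leftAct x + H.leftAct y := by ext x; simp [leftAct]
    simp only [map_add, hx, hy, this, LinearMap.lTensor_add, LinearMap.add_apply]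
  | tmul u v =>
    have h₁ : H.leftAct (u ⊗ₜ v) = r1 A u ∘ₗ H.P v := by
      ext x; exact H.left_tmul_P x u v
    have h₂ : l1 A c ∘ₗ H.P u = r2 A u ∘ₗ H.Q c := by
      ext x; exact H.l1_P c u x
    rw [h₁, LinearMap.lTensor_comp_apply, coassoc_PQ, ← assoc_rTensor_r2,
      ← LinearMap.rTensor_comp_apply, ← h₂, iterated_tmul, rTensor_assoc,
      LinearMap.rTensor_comp_apply]
    rfl

/-- By multiplicativity of `Δ`, `(ι ⊗ Δ)(Δ(e)(1 ⊗ a))` is the twofold coproduct of `e` times `1 ⊗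
Δ(a)`. The identity is used for the group-likeness of the modular element. -/
theorem lTensor_P_P (a d e : A) : (H.P d).lTensor A (H.P a e) = H.iterated e (H.P d a) := by
  refine ext_l1 H.nondeg fun c => ?_
  rw [rTensor_lTensor, rTensor_iterated]
  change (H.P d).lTensor A (l1 A c (H.P a e)) = _
  rw [l1_P, r2, ← LinearMap.lTensor_comp_apply]
  congr 2
  ext x
  exact (H.left_P x d a).symm

end CoverMaps

end CoverMaps

/-! ### The counit and the inverses of the canonical maps -/

namespace CoverMaps

variable {A : Type*} [NonUnitalRing A] [Module ℂ A] [SMulCommClass ℂ A A] [IsScalarTower ℂ A A]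
variable {Δ : A → Mult (A ⊗[ℂ] A)} (H : CoverMaps Δ)

/-- `ε` is the counit: `(ε ⊗ ι)(Δ(b)(1 ⊗ c)) = bc` and `(ι ⊗ ε)((a ⊗ 1)Δ(b)) = ab`. -/
structure IsCounit (ε : A →ₗ[ℂ] ℂ) : Prop where
  sliceL_P : ∀ c b, sliceL A ε (H.P c b) = b * c
  sliceR_Q : ∀ a b, sliceR A ε (H.Q a b) = a * b

/-- The maps `E` and `F` are what `ε ⊗ ι` and `ι ⊗ ε` have to be. Coassociativity gives `c ⊗ E(b ⊗
q) = F(c ⊗ b) ⊗ q`, which makes both of them scalar in the free leg. Here `φ` is any functional with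
`φ(e) = 1`; invariance plays no role. -/
theorem exists_isCounit {φ : A →ₗ[ℂ] ℂ} {e : A} (he : φ e = 1) : ∃ ε, H.IsCounit ε := by
  let μ := LinearMap.mul' ℂ A
  let E : A ⊗[ℂ] A →ₗ[ℂ] A :=
    μ ∘ₗ (TensorProduct.comm ℂ A A).toLinearMap ∘ₗ H.TP.symm.toLinearMap
  have hE : ∀ c b, E (H.P c b) = b * c := fun c b => by simp [E, μ, ← TP_tmul]
  let F : A ⊗[ℂ] A →ₗ[ℂ] A := μ ∘ₗ H.TQ.symm.toLinearMap
  have hF : ∀ a b, F (H.Q a b) = a * b := fun a b => by simp [F, μ, ← TQ_tmul]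
  -- For `x = Δ(u)(1 ⊗ v)`, coassociativity brings `E` onto `Δ(·)(1 ⊗ v)`, where it is right
  -- multiplication by `v`.
  have key₁ : ∀ a x, E.lTensor A (TensorProduct.assoc ℂ A A A ((H.Q a).rTensor A x)) =
      l1 A a x := by
    intro a x
    obtain ⟨w, rfl⟩ := H.TP.surjective x
    induction w using TensorProduct.induction_on with
    | zero => simp
    | add x y hx hy => simp only [map_add, hx, hy]
    | tmul v u =>
      rw [TP_tmul, ← coassoc_PQ, ← LinearMap.lTensor_comp_apply, l1_P, r2]
      congr 2
      ext h
      simp [hE]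
  have key₂ : ∀ y q, E.lTensor A (TensorProduct.assoc ℂ A A A (y ⊗ₜ q)) = F y ⊗ₜ q := by
    intro y q
    obtain ⟨w, rfl⟩ := H.TQ.surjective y
    induction w using TensorProduct.induction_on with
    | zero => simp
    | add x y hx hy => simp only [map_add, TensorProduct.add_tmul, hx, hy]
    | tmul a p =>
      have := key₁ a (p ⊗ₜ q)
      rwa [LinearMap.rTensor_tmul, l1_tmul, ← hF] at this
  have key₃ : ∀ c b q, c ⊗ₜ[ℂ] E (b ⊗ₜ q) = F (c ⊗ₜ b) ⊗ₜ q := fun c b q => by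
    simpa using key₂ (c ⊗ₜ b) q
  -- `key₃` at `c = e`, with `φ` applied to the first leg, exhibits `E(b ⊗ q)` as a multiple of `q`;
  -- this is the factor.
  let ε : A →ₗ[ℂ] ℂ := φ ∘ₗ F ∘ₗ TensorProduct.mk ℂ A A e
  have hε : ∀ b q, E (b ⊗ₜ q) = ε b • q := fun b q => by
    simpa [he, ε] using congrArg (sliceL A φ) (key₃ e b q)
  have hεE : sliceL A ε = E := TensorProduct.ext' fun b q => by simp [hε]
  have hεF : sliceR A ε = F := TensorProduct.ext' fun c b => by
    have := congrArg (sliceR A φ) (key₃ c b e)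
    simpa [he, hε] using this
  exact ⟨ε, ⟨fun c b => by rw [hεE, hE], fun a b => by rw [hεF, hF]⟩⟩

namespace IsCounit

variable {H} {ε : A →ₗ[ℂ] ℂ}

theorem sliceL_L (hε : H.IsCounit ε) (a b : A) : sliceL A ε (H.L a b) = a * b := by
  refine H.nondeg.ext_right fun c => ?_
  have h : sliceL A ε (H.L a b) * c = sliceL A ε (r2 A c (H.L a b)) :=
    (sliceL_lTensor ε (LinearMap.mulRight ℂ c) _).symm
  rw [h, ← l2_P, l2, sliceL_lTensor, hε.sliceL_P, LinearMap.mulLeft_apply, mul_assoc]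

theorem sliceL_left (hε : H.IsCounit ε) (a : A) (y : A ⊗[ℂ] A) :
    sliceL A ε ((Δ a).left y) = a * sliceL A ε y := by
  obtain ⟨w, rfl⟩ := H.TP.surjective y
  induction w using TensorProduct.induction_on with
  | zero => simp
  | add x y hx hy => simp only [map_add, hx, hy, mul_add]
  | tmul v u => rw [TP_tmul, left_P, hε.sliceL_P, hε.sliceL_P, mul_assoc]

/-- For `z = Δ(a)(1 ⊗ b)`, the product is `Δ(a)(c ⊗ b)`, and `Δ(a)` leaves the slice as left
multiplication by `a`. This is the multiplicativity of `ε` in covered form. -/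
theorem sliceL_r1 (hε : H.IsCounit ε) (c : A) (z : A ⊗[ℂ] A) : sliceL A ε (r1 A c z) = ε c • sliceL A ε z := by
  obtain ⟨w, rfl⟩ := H.TP.surjective z
  induction w using TensorProduct.induction_on with
  | zero => simp
  | add x y hx hy => simp only [map_add, hx, hy, smul_add]
  | tmul b a =>
    rw [TP_tmul, ← left_tmul_P, hε.sliceL_left, hε.sliceL_P, sliceL_tmul, mul_smul_comm]

theorem apply_mul (hε : H.IsCounit ε) {φ : A →ₗ[ℂ] ℂ} {e : A} (he : φ e = 1) (a b : A) :
    ε (a * b) = ε a * ε b := by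
  have := congrArg φ (hε.sliceL_r1 b (a ⊗ₜ e))
  simpa [he, mul_comm] using this

end IsCounit

/-- If `T` commutes with a covered coproduct `D`, then `T⁻¹` is expressed by the convolution
inverse `p ↦ (ι ⊗ ε)T⁻¹(a ⊗ p)` of the identity. -/
theorem lTensor_symm_apply (T : A ⊗[ℂ] A ≃ₗ[ℂ] A ⊗[ℂ] A) (D : A →ₗ[ℂ] A ⊗[ℂ] A)
    (ν : A →ₗ[ℂ] A) (ε : A →ₗ[ℂ] ℂ) (hν : ∀ b, sliceL A ε (D b) = ν b)
    (hT : ∀ a b, D.lTensor A (T (a ⊗ₜ b)) = TensorProduct.assoc ℂ A A A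
      ((T.toLinearMap ∘ₗ TensorProduct.mk ℂ A A a).rTensor A (D b))) (a b : A) :
    ν.lTensor A (T.symm (a ⊗ₜ b)) =
      (sliceR A ε ∘ₗ T.symm.toLinearMap ∘ₗ TensorProduct.mk ℂ A A a).rTensor A (D b) := by
  -- This is `hT` with `T⁻¹` applied to the first two legs.
  have key : ∀ w : A ⊗[ℂ] A, (T.symm.toLinearMap.rTensor A ((TensorProduct.assoc ℂ A A A).symm
      (D.lTensor A (T w)))) = (TensorProduct.assoc ℂ A A A).symm (D.lTensor A w) := by
    intro w
    induction w using TensorProduct.induction_on with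
    | zero => simp
    | add x y hx hy => simp only [map_add, hx, hy]
    | tmul v u =>
      rw [hT, LinearEquiv.symm_apply_apply, ← LinearMap.rTensor_comp_apply]
      rw [LinearMap.lTensor_tmul, LinearEquiv.eq_symm_apply]
      generalize D u = z
      induction z using TensorProduct.induction_on with
      | zero => simp
      | add x y hx hy => simp only [map_add, TensorProduct.tmul_add, hx, hy]
      | tmul v w => simp
  -- Applying `ε` to the middle leg contracts `D` to `ν` on one side and leaves the slice of `T⁻¹`
  -- on the other.
  have h := congrArg ((sliceR A ε).rTensor A) (key (T.symm (a ⊗ₜ b)))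
  rw [LinearEquiv.apply_symm_apply] at h
  have hν' : ν = sliceL A ε ∘ₗ D := by ext x; exact (hν x).symm
  rw [hν', LinearMap.lTensor_comp_apply, ← (TensorProduct.assoc ℂ A A A).apply_symm_apply
    (D.lTensor A _), lTensor_sliceL_assoc, ← h, LinearMap.lTensor_tmul]
  generalize D b = z
  induction z using TensorProduct.induction_on with
  | zero => simp
  | add x y hx hy => simp only [map_add, TensorProduct.tmul_add, hx, hy]
  | tmul v w => simp

end CoverMaps

/-! ### The inverse antipode and uniqueness of left integrals -/

namespace CoverMaps

variable {A : Type*} [NonUnitalRing A] [Module ℂ A] [SMulCommClass ℂ A A] [IsScalarTower ℂ A A]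
variable {Δ : A → Mult (A ⊗[ℂ] A)} (H : CoverMaps Δ)

/-- Left invariance, covered from the right: `(ι ⊗ φ)(Δ(a)(c ⊗ 1)) = φ(a)c`. -/
def LeftInvariant (φ : A →ₗ[ℂ] ℂ) : Prop := ∀ c a, sliceR A φ (H.R c a) = φ a • c

/-- Right invariance, covered from the right: `(ψ ⊗ ι)(Δ(a)(1 ⊗ c)) = ψ(a)c`. -/
def RightInvariant (ψ : A →ₗ[ℂ] ℂ) : Prop := ∀ c a, sliceL A ψ (H.P c a) = ψ a • c

/-- `S` is the inverse of the antipode of a multiplier Hopf algebra with counit `ε`: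
`S(p)a = (ι ⊗ ε)(TR⁻¹(a ⊗ p))`. -/
def IsInverseAntipode (ε : A →ₗ[ℂ] ℂ) (S : A →ₗ[ℂ] A) : Prop :=
  ∀ p a, S p * a = sliceR A ε (H.TR.symm (a ⊗ₜ p))

theorem sliceR_l1 (φ : A →ₗ[ℂ] ℂ) (a : A) (z : A ⊗[ℂ] A) :
    sliceR A φ (l1 A a z) = a * sliceR A φ z := sliceR_rTensor φ (LinearMap.mulLeft ℂ a) z

theorem sliceR_r1 (φ : A →ₗ[ℂ] ℂ) (a : A) (z : A ⊗[ℂ] A) :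
    sliceR A φ (r1 A a z) = sliceR A φ z * a := sliceR_rTensor φ (LinearMap.mulRight ℂ a) z

theorem sliceL_l2 (φ : A →ₗ[ℂ] ℂ) (a : A) (z : A ⊗[ℂ] A) :
    sliceL A φ (l2 A a z) = a * sliceL A φ z := sliceL_lTensor φ (LinearMap.mulLeft ℂ a) z

theorem sliceL_r2 (φ : A →ₗ[ℂ] ℂ) (a : A) (z : A ⊗[ℂ] A) :
    sliceL A φ (r2 A a z) = sliceL A φ z * a := sliceL_lTensor φ (LinearMap.mulRight ℂ a) z

theorem slice_swap (θ ψ : A →ₗ[ℂ] ℂ) (z : A ⊗[ℂ] A) :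
    θ (sliceL A ψ z) = ψ (sliceR A θ z) := by
  induction z using TensorProduct.induction_on with
  | zero => simp
  | add y y' hy hy' => simp only [map_add, hy, hy']
  | tmul x y => simp [mul_comm]

variable {H} {φ ε : A →ₗ[ℂ] ℂ}

theorem LeftInvariant.sliceR_TR (hφ : H.LeftInvariant φ) (z : A ⊗[ℂ] A) :
    sliceR A φ (H.TR z) = sliceR A φ z := by
  induction z using TensorProduct.induction_on with
  | zero => simp
  | add x y hx hy => simp only [map_add, hx, hy]
  | tmul c a => rw [TR_tmul, hφ, sliceR_tmul]

theorem sliceR_TQ (hφ : ∀ c a, sliceR A φ (H.Q c a) = φ a • c) (z : A ⊗[ℂ] A) :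
    sliceR A φ (H.TQ z) = sliceR A φ z := by
  induction z using TensorProduct.induction_on with
  | zero => simp
  | add x y hx hy => simp only [map_add, hx, hy]
  | tmul c a => rw [TQ_tmul, hφ, sliceR_tmul]

/-- Writing `a ⊗ b = TR(z)`, one has `Δ(x)TR(z) = TR((1 ⊗ x)z)`, and left invariance deletes `TR`.
What remains is a slice of `(1 ⊗ x)TR⁻¹(a ⊗ b)`, computed by `lTensor_symm_apply`. -/
theorem LeftInvariant.sliceR_P_mul (hφ : H.LeftInvariant φ) (hε : H.IsCounit ε) (b x a : A) :
    sliceR A φ (H.P b x) * a =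
      sliceR A ε (H.TR.symm (a ⊗ₜ sliceR A φ (H.L x b))) := by
  have h := lTensor_symm_apply H.TR (H.L x) (LinearMap.mulLeft ℂ x) ε
    (fun b => hε.sliceL_L x b) (fun a b => H.coassoc_LR a b x) a b
  rw [← sliceR_r1, ← left_tmul_P, ← H.TR.apply_symm_apply (a ⊗ₜ b), left_TR, hφ.sliceR_TR, l2, h,
    sliceR_rTensor]
  rfl

/-- The mirror image of `LeftInvariant.sliceR_P_mul`, with `TQ` for `TR`; it supplies the antipode
itself, inverse to `S`. -/
theorem mul_sliceR_L (hφ : ∀ c a, sliceR A φ (H.Q c a) = φ a • c) (hε : H.IsCounit ε)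
    (b x a : A) :
    a * sliceR A φ (H.L b x) =
      sliceR A ε (H.TQ.symm (a ⊗ₜ sliceR A φ (H.P x b))) := by
  have h := lTensor_symm_apply H.TQ (H.P x) (LinearMap.mulRight ℂ x) ε
    (fun b => hε.sliceL_P x b) (fun a b => H.coassoc_PQ a b x) a b
  rw [← sliceR_l1, ← right_tmul_L, ← H.TQ.apply_symm_apply (a ⊗ₜ b), right_TQ, sliceR_TQ hφ, r2, h,
    sliceR_rTensor]
  rfl

theorem LeftInvariant.antipode_sliceR_L (hφ : H.LeftInvariant φ) (hε : H.IsCounit ε)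
    {S : A →ₗ[ℂ] A} (hS : H.IsInverseAntipode ε S) (x b : A) :
    S (sliceR A φ (H.L x b)) = sliceR A φ (H.P b x) :=
  H.nondeg.ext_right fun a => by rw [hS, hφ.sliceR_P_mul hε]

/-- A left integral makes the inverse antipode a bijection of `A`. -/
theorem exists_isInverseAntipode (hφ : H.LeftInvariant φ)
    (hφ' : ∀ c a, sliceR A φ (H.Q c a) = φ a • c) (hε : H.IsCounit ε) {e : A} (he : φ e = 1) :
    ∃ S : A ≃ₗ[ℂ] A, H.IsInverseAntipode ε S.toLinearMap := by
  let κ := TensorProduct.comm ℂ A A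
  -- Since `φ(e) = 1`, the element `p` is the slice of `p ⊗ e = TL(w)`, and the slice formula then
  -- prescribes its image. `S'` uses the same formula backwards.
  let S : A →ₗ[ℂ] A := sliceR A φ ∘ₗ H.TP.toLinearMap ∘ₗ κ.toLinearMap ∘ₗ H.TL.symm.toLinearMap ∘ₗ
    (TensorProduct.mk ℂ A A).flip e
  let S' : A →ₗ[ℂ] A := sliceR A φ ∘ₗ H.TL.toLinearMap ∘ₗ κ.toLinearMap ∘ₗ H.TP.symm.toLinearMap ∘ₗ
    (TensorProduct.mk ℂ A A).flip e
  have h₁ : ∀ w a, sliceR A φ (H.TP (κ w)) * a =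
      sliceR A ε (H.TR.symm (a ⊗ₜ sliceR A φ (H.TL w))) := by
    intro w a
    induction w using TensorProduct.induction_on with
    | zero => simp
    | add x y hx hy => simp only [map_add, add_mul, TensorProduct.tmul_add, hx, hy]
    | tmul x b => exact hφ.sliceR_P_mul hε b x a
  have h₂ : ∀ w a, a * sliceR A φ (H.TL (κ w)) =
      sliceR A ε (H.TQ.symm (a ⊗ₜ sliceR A φ (H.TP w))) := by
    intro w a
    induction w using TensorProduct.induction_on with
    | zero => simp
    | add x y hx hy => simp only [map_add, mul_add, TensorProduct.tmul_add, hx, hy]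
    | tmul x b => exact mul_sliceR_L hφ' hε b x a
  have hS : H.IsInverseAntipode ε S := by
    intro p a
    have := h₁ (H.TL.symm (p ⊗ₜ e)) a
    rw [LinearEquiv.apply_symm_apply, sliceR_tmul, he, one_smul] at this
    exact this
  have hS' : ∀ p a, a * S' p = sliceR A ε (H.TQ.symm (a ⊗ₜ p)) := by
    intro p a
    have := h₂ (H.TP.symm (p ⊗ₜ e)) a
    rw [LinearEquiv.apply_symm_apply, sliceR_tmul, he, one_smul] at this
    exact this
  have k₁ : ∀ w, S (sliceR A φ (H.TL w)) = sliceR A φ (H.TP (κ w)) := fun w =>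
    H.nondeg.ext_right fun a => by rw [hS, h₁]
  have k₂ : ∀ w, S' (sliceR A φ (H.TP w)) = sliceR A φ (H.TL (κ w)) := fun w =>
    H.nondeg.ext_left fun a => by rw [hS', h₂]
  have hκ : ∀ w, κ (κ w) = w := fun w => κ.symm_apply_apply w
  refine ⟨LinearEquiv.ofLinearMap S S' ?_ ?_, hS⟩
  · ext p
    obtain ⟨w, hw⟩ := H.TP.surjective (p ⊗ₜ e)
    have : p = sliceR A φ (H.TP w) := by rw [hw, sliceR_tmul, he, one_smul]
    rw [this, LinearMap.comp_apply, k₂, k₁, hκ, LinearMap.id_apply]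
  · ext p
    obtain ⟨w, hw⟩ := H.TL.surjective (p ⊗ₜ e)
    have : p = sliceR A φ (H.TL w) := by rw [hw, sliceR_tmul, he, one_smul]
    rw [this, LinearMap.comp_apply, k₁, k₂, hκ, LinearMap.id_apply]

/-- The counit is multiplicative, so right multiplication by `1 ⊗ b` leaves `(ι ⊗ ε)TR⁻¹` as left
multiplication by `S(b)`. The case `a ⊗ d` is the claim, tested against `a`. -/
theorem IsInverseAntipode.apply_mul {S : A →ₗ[ℂ] A} (hS : H.IsInverseAntipode ε S)
    (hε : H.IsCounit ε) {e : A} (he : φ e = 1) (d b : A) : S (d * b) = S b * S d := by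
  have hl2 : ∀ (d : A) (w : A ⊗[ℂ] A), sliceR A ε (l2 A d w) = ε d • sliceR A ε w := by
    intro d w
    induction w using TensorProduct.induction_on with
    | zero => simp
    | add x y hx hy => simp only [map_add, smul_add, hx, hy]
    | tmul x y => simp [hε.apply_mul he, mul_smul]
  have key : ∀ z, sliceR A ε (H.TR.symm (r2 A b z)) = S b * sliceR A ε (H.TR.symm z) := by
    intro z
    obtain ⟨w, rfl⟩ := H.TR.surjective z
    induction w using TensorProduct.induction_on with
    | zero => simp
    | add x y hx hy => simp only [map_add, mul_add, hx, hy]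
    | tmul a d =>
      rw [LinearEquiv.symm_apply_apply, TR_tmul, ← left_tmul_R,
        ← H.TR.apply_symm_apply (a ⊗ₜ b), left_TR, LinearEquiv.symm_apply_apply, hl2, ← hS,
        sliceR_tmul, mul_smul_comm]
  refine H.nondeg.ext_right fun a => ?_
  rw [mul_assoc, hS (d * b), hS d, ← key, r2_tmul]

/-- The inverse antipode reverses the coproduct. -/
theorem LeftInvariant.R_antipode (hφ : H.LeftInvariant φ) (hε : H.IsCounit ε) {e : A}
    (he : φ e = 1) {S : A ≃ₗ[ℂ] A} (hS : H.IsInverseAntipode ε S.toLinearMap) (g p : A) :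
    H.R (S g) (S p) =
      TensorProduct.comm ℂ A A (TensorProduct.map S.toLinearMap S.toLinearMap (H.L g p)) := by
  have hmul : ∀ d b, S (d * b) = S b * S d := hS.apply_mul hε he
  have hanti : ∀ x b, S (sliceR A φ (H.L x b)) = sliceR A φ (H.P b x) :=
    hφ.antipode_sliceR_L hε hS
  -- For a slice `p = (ι ⊗ φ)((1 ⊗ x)Δ(b))`, the image `S(p)` is a slice of `Δ(x)(1 ⊗ b)`, whose
  -- coproduct is accessible by coassociativity. The factor `S(f)` covers the second leg.
  have key : ∀ (a f x b : A), r2 A (S f) (H.R a (S (sliceR A φ (H.L x b)))) =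
      TensorProduct.comm ℂ A A (TensorProduct.map S.toLinearMap
        (LinearMap.mulRight ℂ a ∘ₗ S.toLinearMap) (H.Q f (sliceR A φ (H.L x b)))) := by
    intro a f x b
    have h₁ : H.R a (S (sliceR A φ (H.L x b))) =
        (sliceR A φ ∘ₗ H.P b).lTensor A (H.R a x) := by
      rw [hanti, ← sliceR_rTensor, ← lTensor_sliceR_assoc, ← coassoc_PR,
        ← LinearMap.lTensor_comp_apply]
    -- The tensor `(f ⊗ 1)Δ(b)` is replaced by an arbitrary `y`: on `u ⊗ v` the map `N` is `φ(· v)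
    -- S(u)`, and the slice formula applies to `x` and `v`.
    have h₂ : ∀ y : A ⊗[ℂ] A, ∀ N : A →ₗ[ℂ] A, (∀ h, N h = S (sliceR A φ (l2 A h y))) →
        N.lTensor A (H.R a x) = TensorProduct.comm ℂ A A (TensorProduct.map S.toLinearMap
          (LinearMap.mulRight ℂ a ∘ₗ S.toLinearMap ∘ₗ sliceR A φ ∘ₗ H.L x) y) := by
      intro y
      induction y using TensorProduct.induction_on with
      | zero =>
        intro N hN
        have : N = 0 := by ext h; simp [hN]
        simp [this]
      | add y y' hy hy' =>
        intro N hN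
        have lin : ∀ y : A ⊗[ℂ] A, ∃ N : A →ₗ[ℂ] A, ∀ h, N h = S (sliceR A φ (l2 A h y)) := by
          intro y
          induction y using TensorProduct.induction_on with
          | zero => exact ⟨0, by simp⟩
          | add y y' hy hy' =>
            obtain ⟨M, hM⟩ := hy
            obtain ⟨M', hM'⟩ := hy'
            exact ⟨M + M', by simp [hM, hM']⟩
          | tmul u v => exact ⟨(φ ∘ₗ LinearMap.mulRight ℂ v).smulRight (S u), by simp⟩
        obtain ⟨M, hM⟩ := lin y
        obtain ⟨M', hM'⟩ := lin y'
        have : N = M + M' := by ext h; simp [hN, hM, hM']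
        rw [this, LinearMap.lTensor_add, LinearMap.add_apply, hy M hM, hy' M' hM', map_add, map_add]
      | tmul u v =>
        intro N hN
        have hN' : N = (φ ∘ₗ LinearMap.mulRight ℂ v).smulRight (S u) := by ext h; simp [hN]
        have h₃ : ∀ z : A ⊗[ℂ] A, N.lTensor A z = sliceR A φ (r2 A v z) ⊗ₜ S u := by
          intro z
          rw [hN']
          induction z using TensorProduct.induction_on with
          | zero => simp
          | add y y' hy hy' => simp only [map_add, hy, hy', TensorProduct.add_tmul]
          | tmul x y => simp [TensorProduct.smul_tmul]
        rw [h₃, ← left_tmul_R, left_tmul_P, sliceR_r1, ← hanti]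
        simp
    rw [h₁, r2, ← LinearMap.lTensor_comp_apply, h₂ (H.Q f b)]
    · rw [← sliceR_rTensor, ← lTensor_sliceR_assoc, ← coassoc_LQ, ← LinearMap.lTensor_comp_apply]
      congr 1
      generalize H.Q f b = z
      induction z using TensorProduct.induction_on with
      | zero => simp
      | add y y' hy hy' => simp only [map_add, hy, hy']
      | tmul x y => simp
    · intro h
      rw [← l1_L, sliceR_l1, hmul, hanti]
      rfl
  obtain ⟨w, hw⟩ := H.TL.surjective (p ⊗ₜ e)
  have hp : p = sliceR A φ (H.TL w) := by rw [hw, sliceR_tmul, he, one_smul]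
  have key' : ∀ a f, r2 A (S f) (H.R a (S p)) =
      TensorProduct.comm ℂ A A (TensorProduct.map S.toLinearMap
        (LinearMap.mulRight ℂ a ∘ₗ S.toLinearMap) (H.Q f p)) := by
    intro a f
    rw [hp]
    clear hp hw
    induction w using TensorProduct.induction_on with
    | zero => simp
    | add y y' hy hy' => simp only [map_add, hy, hy']
    | tmul x b => exact key a f x b
  -- By surjectivity of `S` the covering factors `S(f)` suffice, and they cancel by non-degeneracy.
  refine ext_r2 H.nondeg fun t => ?_
  obtain ⟨f, rfl⟩ := S.surjective t
  rw [key']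
  have h₄ : ∀ z : A ⊗[ℂ] A, TensorProduct.map S.toLinearMap
      (LinearMap.mulRight ℂ (S g) ∘ₗ S.toLinearMap) z =
        TensorProduct.map S.toLinearMap S.toLinearMap (l2 A g z) := by
    intro z
    induction z using TensorProduct.induction_on with
    | zero => simp
    | add y y' hy hy' => simp only [map_add, hy, hy']
    | tmul x y => simp [hmul]
  rw [h₄, ← l1_L]
  generalize H.L g p = z
  induction z using TensorProduct.induction_on with
  | zero => simp
  | add y y' hy hy' => simp only [map_add, hy, hy']
  | tmul x y => simp [hmul]

/-- Composition with the inverse antipode turns a left integral into a right integral. -/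
theorem LeftInvariant.comp_antipode (hφ : H.LeftInvariant φ) (hε : H.IsCounit ε) {e : A}
    (he : φ e = 1) {S : A ≃ₗ[ℂ] A} (hS : H.IsInverseAntipode ε S.toLinearMap) :
    (∀ g p, sliceL A (φ ∘ₗ S.toLinearMap) (H.L g p) = φ (S p) • g) ∧
      H.RightInvariant (φ ∘ₗ S.toLinearMap) := by
  have h : ∀ g p, sliceL A (φ ∘ₗ S.toLinearMap) (H.L g p) = φ (S p) • g := by
    intro g p
    apply S.injective
    rw [map_smul, ← hφ, hφ.R_antipode hε he hS, sliceR_comm]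
    generalize H.L g p = z
    induction z using TensorProduct.induction_on with
    | zero => simp
    | add y y' hy hy' => simp only [map_add, hy, hy']
    | tmul x y => simp
  refine ⟨h, fun q p => H.nondeg.ext_left fun c => ?_⟩
  rw [← sliceL_l2, l2_P, sliceL_r2, h]
  simp [smul_mul_assoc, mul_smul_comm]

/-- Left integrals are unique up to a scalar. -/
theorem LeftInvariant.unique (hφ : H.LeftInvariant φ)
    (hφQ : ∀ c a, sliceR A φ (H.Q c a) = φ a • c) {e : A} (he : φ e = 1)
    {φ' : A →ₗ[ℂ] ℂ} (hφ' : H.LeftInvariant φ') : ∃ r : ℂ, φ' = r • φ := by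
  obtain ⟨ε, hε⟩ := H.exists_isCounit he
  obtain ⟨S, hS⟩ := exists_isInverseAntipode hφ hφQ hε he
  obtain ⟨hL, hψ⟩ := hφ.comp_antipode hε he hS
  set ψ := φ ∘ₗ S.toLinearMap with hψdef
  obtain ⟨t, ht⟩ := S.surjective e
  have ht : ψ t = 1 := by simp [hψdef, ht, he]
  -- `hP` and `hR` evaluate `(ψ ⊗ θ)(Δ(x)y)` for `y` in the image of `TP` and of `TR`. Both images
  -- are all of `A ⊗ A`, so the results can be compared.
  have hP : ∀ (θ : A →ₗ[ℂ] ℂ) (x : A) (w : A ⊗[ℂ] A),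
      θ (sliceL A ψ ((Δ x).left (H.TP w))) = ψ (x * sliceL A θ w) := by
    intro θ x w
    induction w using TensorProduct.induction_on with
    | zero => simp
    | add y y' hy hy' => simp only [map_add, mul_add, hy, hy']
    | tmul q p => rw [TP_tmul, left_P, hψ]; simp [mul_smul_comm, mul_comm]
  have hR : ∀ (θ : A →ₗ[ℂ] ℂ), H.LeftInvariant θ → ∀ (x : A) (w : A ⊗[ℂ] A),
      θ (sliceL A ψ ((Δ x).left (H.TR w))) = θ (x * sliceL A ψ w) := by
    intro θ hθ x w
    rw [slice_swap]
    induction w using TensorProduct.induction_on with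
    | zero => simp
    | add y y' hy hy' => simp only [map_add, mul_add, hy, hy']
    | tmul q p => rw [TR_tmul, left_R, hθ]; simp [mul_smul_comm, mul_comm]
  -- the functionals `φ'(· t)` and `φ(· c)` agree
  obtain ⟨d, hd⟩ : ∃ d, ∀ x, φ' (x * t) = ψ (x * d) := by
    -- Here `y = TR(t ⊗ t)`, and `ψ(t) = 1` leaves `φ'(xt)`. Below, `y = TP(e ⊗ d)` and `φ(e) = 1`.
    refine ⟨sliceL A φ' (H.TP.symm (H.TR (t ⊗ₜ t))), fun x => ?_⟩
    rw [← hP, LinearEquiv.apply_symm_apply, hR φ' hφ', sliceL_tmul, ht, one_smul]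
  obtain ⟨c, hc⟩ : ∃ c, ∀ x, ψ (x * d) = φ (x * c) := by
    refine ⟨sliceL A ψ (H.TR.symm (H.TP (e ⊗ₜ d))), fun x => ?_⟩
    rw [← hR φ hφ, LinearEquiv.apply_symm_apply, hP, sliceL_tmul, he, one_smul]
  have hslice : ∀ x, sliceR A φ' (H.P t x) = sliceR A φ (H.P c x) := by
    intro x
    refine H.nondeg.ext_right fun a => ?_
    rw [← sliceR_r1, ← sliceR_r1, r1_P, r1_P, r2, r2, sliceR_lTensor, sliceR_lTensor]
    congr 2
    ext y
    simp [hd, hc]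
  have hfinal : ∀ (θ : A →ₗ[ℂ] ℂ) (x a : A), ψ (sliceR A θ (H.L x a)) = ψ a * θ x := by
    intro θ x a
    rw [← slice_swap, hL]
    simp [hψdef]
  refine ⟨ψ c, LinearMap.ext fun x => ?_⟩
  -- Both slices are values of `S`, so `φ` of them is `ψ` of slices of `(1 ⊗ x)Δ(·)`, which right
  -- invariance evaluates.
  have h := congrArg φ (hslice x)
  rw [← hφ'.antipode_sliceR_L hε hS, ← hφ.antipode_sliceR_L hε hS] at h
  change ψ _ = ψ _ at h
  rw [hfinal, hfinal, ht, one_mul] at h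
  simpa using h

end CoverMaps

/-! ### The modular element and its group-likeness -/

namespace CoverMaps

variable {A : Type*} [NonUnitalRing A] [Module ℂ A] [SMulCommClass ℂ A A] [IsScalarTower ℂ A A]
variable {Δ : A → Mult (A ⊗[ℂ] A)} {H : CoverMaps Δ} {φ : A →ₗ[ℂ] ℂ}

theorem leftInvariant_of_isLeftIntegral (hφ : IsLeftIntegral Δ φ) : H.LeftInvariant φ := by
  intro c a
  obtain ⟨x, hx, hx'⟩ := (hφ.2 a c).1
  rw [← H.incl_R] at hx
  rw [← Mult.incl_injective H.nondeg₂ hx]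
  exact hx'

theorem sliceR_Q_of_isLeftIntegral (hφ : IsLeftIntegral Δ φ) (c a : A) :
    sliceR A φ (H.Q c a) = φ a • c := by
  obtain ⟨x, hx, hx'⟩ := (hφ.2 a c).2
  rw [← H.incl_Q] at hx
  rw [← Mult.incl_injective H.nondeg₂ hx]
  exact hx'

theorem exists_apply_eq_one (hφ : IsLeftIntegral Δ φ) : ∃ e, φ e = 1 := by
  obtain ⟨a, ha⟩ : ∃ a, φ a ≠ 0 := by
    by_contra! h
    exact hφ.1 (LinearMap.ext h)
  exact ⟨(φ a)⁻¹ • a, by simp [ha]⟩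

variable (H) in
theorem isModularElement_iff {δ : Mult A} : IsModularElement Δ φ δ ↔
    (∀ a b, sliceL A φ (H.P b a) = φ a • δ.left b) ∧
      (∀ a b, sliceL A φ (H.L b a) = φ a • δ.right b) := by
  constructor
  · intro h
    constructor
    · intro a b
      obtain ⟨x, hx, hx'⟩ := (h a b).1
      rw [← H.incl_P] at hx
      rw [← Mult.incl_injective H.nondeg₂ hx]
      exact hx'
    · intro a b
      obtain ⟨x, hx, hx'⟩ := (h a b).2
      rw [← H.incl_L] at hx
      rw [← Mult.incl_injective H.nondeg₂ hx]
      exact hx'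
  · intro h a b
    exact ⟨⟨_, H.incl_P b a, h.1 a b⟩, ⟨_, H.incl_L b a, h.2 a b⟩⟩

/-- A left integral has a unique modular element. -/
theorem existsUnique_isModularElement (H : CoverMaps Δ) (hφ : IsLeftIntegral Δ φ) :
    ∃! δ : Mult A, IsModularElement Δ φ δ := by
  obtain ⟨e, he⟩ := exists_apply_eq_one hφ
  have hinv : H.LeftInvariant φ := leftInvariant_of_isLeftIntegral hφ
  have key : ∀ a b, sliceL A φ (H.P b a) = φ a • sliceL A φ (H.P b e) := by
    intro a b
    rw [← sub_eq_zero]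
    refine eq_zero_of_dual fun ω => ?_
    let φ' : A →ₗ[ℂ] ℂ := ω ∘ₗ sliceL A φ ∘ₗ H.P b
    -- Coassociativity lets `φ` act on the second leg of `Δ(·)(c ⊗ 1)`, where its invariance
    -- produces `c`.
    have hφ' : H.LeftInvariant φ' := by
      intro c a
      change sliceR A ((ω ∘ₗ sliceL A φ) ∘ₗ H.P b) (H.R c a) = _
      rw [← sliceR_lTensor, coassoc_PR]
      have h : ∀ z : (A ⊗[ℂ] A) ⊗[ℂ] A, sliceR A (ω ∘ₗ sliceL A φ)
          (TensorProduct.assoc ℂ A A A z) = sliceR A ω ((sliceR A φ).rTensor A z) := by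
        intro z
        rw [← sliceR_lTensor, lTensor_sliceL_assoc]
      rw [h, ← LinearMap.rTensor_comp_apply, sliceR_rTensor, LinearMap.comp_apply, hinv,
        ← slice_swap]
      rfl
    obtain ⟨r, hr⟩ := hinv.unique (sliceR_Q_of_isLeftIntegral hφ) he hφ'
    have h₁ : ω (sliceL A φ (H.P b a)) = r * φ a := by
      simpa [φ'] using LinearMap.congr_fun hr a
    have h₂ : ω (sliceL A φ (H.P b e)) = r := by
      simpa [φ', he] using LinearMap.congr_fun hr e
    rw [map_sub, map_smul, h₁, h₂, smul_eq_mul, mul_comm, sub_self]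
  have hcentral : ∀ a b c, sliceL A φ (H.L b a) * c = b * sliceL A φ (H.P c a) := by
    intro a b c
    rw [← sliceL_r2, ← l2_P, sliceL_l2]
  let δ : Mult A := Mult.mk (sliceL A φ ∘ₗ H.TP.toLinearMap ∘ₗ (TensorProduct.mk ℂ A A).flip e)
    (sliceL A φ ∘ₗ H.TL.toLinearMap ∘ₗ (TensorProduct.mk ℂ A A).flip e) (fun b c => hcentral e b c)
  have hδl : ∀ b, δ.left b = sliceL A φ (H.P b e) := fun b => rfl
  have hδr : ∀ b, δ.right b = sliceL A φ (H.L b e) := fun b => rfl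
  refine ⟨δ, H.isModularElement_iff.2 ⟨fun a b => ?_, fun a b => ?_⟩, fun δ' h' => ?_⟩
  · rw [hδl, key]
  · refine H.nondeg.ext_right fun c => ?_
    rw [hcentral, key, hδr, smul_mul_assoc, hcentral, mul_smul_comm]
  · refine Mult.ext_left H.nondeg fun b => ?_
    rw [hδl, (H.isModularElement_iff.1 h').1, he, one_smul]

variable (H) in
/-- The modular element is group-like. -/
theorem map_modular_P (hφ : IsLeftIntegral Δ φ) {δ : Mult A} (hδ : IsModularElement Δ φ δ)
    (d a : A) : TensorProduct.map δ.left δ.left (H.P d a) = H.P d (δ.left a) := by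
  obtain ⟨e, he⟩ := exists_apply_eq_one hφ
  have h := (H.isModularElement_iff.1 hδ).1
  have hl : ∀ b, sliceL A φ (H.P b e) = δ.left b := fun b => by rw [h, he, one_smul]
  -- With `δa` written as a slice of `Δ(e)(1 ⊗ a)`, its coproduct becomes a slice of the twofold
  -- coproduct of `e` times `1 ⊗ Δ(a)(1 ⊗ d)`.
  rw [← hl a, ← sliceL_lTensor, lTensor_P_P]
  generalize H.P d a = z
  induction z using TensorProduct.induction_on with
  | zero => simp
  | add y y' hy hy' => simp only [map_add, hy, hy']
  | tmul u v =>
    rw [iterated_tmul, sliceL_assoc, ← LinearMap.rTensor_comp_apply]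
    -- The inner slice produces `δu` and leaves `φ` on the outer coproduct, whose slice is `δv`.
    have h' : sliceL A φ ∘ₗ H.P u = φ.smulRight (δ.left u) := by
      ext x
      simp [h]
    have h'' : ∀ z : A ⊗[ℂ] A, (φ.smulRight (δ.left u)).rTensor A z =
        δ.left u ⊗ₜ[ℂ] sliceL A φ z := by
      intro z
      induction z using TensorProduct.induction_on with
      | zero => simp
      | add y y' hy hy' => simp only [map_add, TensorProduct.tmul_add, hy, hy']
      | tmul u v => simp [TensorProduct.smul_tmul]
    rw [h', h'', hl, TensorProduct.map_tmul]

end CoverMaps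

/-! ### Restriction to the summands of a direct sum of algebras -/

section Graded

variable {A : Type*} [NonUnitalRing A] [Module ℂ A] [SMulCommClass ℂ A A] [IsScalarTower ℂ A A]
variable {G : Type*} [DecidableEq G] {𝒜 : G → NonUnitalSubalgebra ℂ A}

namespace IsAlgebraDirectSum

theorem proj_summandIncl_self (h : IsAlgebraDirectSum 𝒜) (p : G) (a : 𝒜 p) :
    h.proj p (summandIncl 𝒜 p a) = a := by
  rw [proj_summandIncl, dif_pos rfl]

/-- Mixed terms vanish because distinct summands annihilate each other and each summand is closed
under products. -/
theorem proj_mul (h : IsAlgebraDirectSum 𝒜) (p : G) (x y : A) :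
    h.proj p (x * y) = h.proj p x * h.proj p y := by
  refine h.sum_induction (P := fun y => h.proj p (x * y) = h.proj p x * h.proj p y)
    (by simp) (fun y y' hy hy' => by rw [mul_add, map_add, hy, hy', map_add, mul_add]) ?_ y
  intro r c
  by_cases e : r = p
  · subst e
    rw [proj_mul_right, proj_summandIncl_self]
  · have h0 : h.proj p (summandIncl 𝒜 r c) = 0 := by rw [proj_summandIncl, dif_neg e]
    rw [h0, mul_zero]
    refine h.sum_induction (P := fun x => h.proj p (x * summandIncl 𝒜 r c) = 0)
      (by simp) (fun x x' hx hx' => by rw [add_mul, map_add, hx, hx', add_zero]) ?_ x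
    intro s d
    by_cases e' : s = r
    · subst e'
      have : summandIncl 𝒜 s d * summandIncl 𝒜 s c = summandIncl 𝒜 s (d * c) := rfl
      rw [this, proj_summandIncl, dif_neg e]
    · have : summandIncl 𝒜 s d * summandIncl 𝒜 r c = 0 := h.mul_eq_zero s r e' _ d.2 _ c.2
      rw [this, map_zero]

theorem summandIncl_mul (p : G) (a : 𝒜 p) (h : IsAlgebraDirectSum 𝒜) (x : A) :
    summandIncl 𝒜 p a * x = summandIncl 𝒜 p (a * h.proj p x) := by
  refine h.sum_induction
    (P := fun x => summandIncl 𝒜 p a * x = summandIncl 𝒜 p (a * h.proj p x))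
    (by simp) (fun y y' hy hy' => by rw [mul_add, hy, hy', map_add, mul_add, map_add]) ?_ x
  intro r c
  by_cases e : r = p
  · subst e
    rw [proj_summandIncl_self]
    rfl
  · have : summandIncl 𝒜 p a * summandIncl 𝒜 r c = 0 :=
      h.mul_eq_zero p r (Ne.symm e) _ a.2 _ c.2
    rw [this, proj_summandIncl, dif_neg e, mul_zero, map_zero]

theorem mul_summandIncl (p : G) (a : 𝒜 p) (h : IsAlgebraDirectSum 𝒜) (x : A) :
    x * summandIncl 𝒜 p a = summandIncl 𝒜 p (h.proj p x * a) := by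
  refine h.sum_induction
    (P := fun x => x * summandIncl 𝒜 p a = summandIncl 𝒜 p (h.proj p x * a))
    (by simp) (fun y y' hy hy' => by rw [add_mul, hy, hy', map_add, add_mul, map_add]) ?_ x
  intro r c
  by_cases e : r = p
  · subst e
    rw [proj_summandIncl_self]
    rfl
  · have : summandIncl 𝒜 r c * summandIncl 𝒜 p a = 0 := h.mul_eq_zero r p e _ c.2 _ a.2
    rw [this, proj_summandIncl, dif_neg e, zero_mul, map_zero]

/-- The summands of an algebra with non-degenerate product have non-degenerate product. -/
theorem nondegenerate (h : IsAlgebraDirectSum 𝒜) (hA : NondegenerateProduct A) (p : G) :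
    NondegenerateProduct (𝒜 p) := by
  constructor
  · intro a ha
    have : summandIncl 𝒜 p a = 0 := hA.1 _ fun x => by
      rw [summandIncl_mul p a h, ha, map_zero]
    rw [← h.proj_summandIncl_self p a, this, map_zero]
  · intro a ha
    have : summandIncl 𝒜 p a = 0 := hA.2 _ fun x => by
      rw [mul_summandIncl p a h, ha, map_zero]
    rw [← h.proj_summandIncl_self p a, this, map_zero]

/-- The component of a multiplier is its restriction. -/
theorem summandIncl_component_left (h : IsAlgebraDirectSum 𝒜) (hA : NondegenerateProduct A)
    (m : Mult A) (p : G) (a : 𝒜 p) :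
    summandIncl 𝒜 p ((h.component p m).left a) = m.left (summandIncl 𝒜 p a) := by
  refine hA.ext_left fun y => ?_
  change y * summandIncl 𝒜 p (h.proj p (m.left (summandIncl 𝒜 p a))) = _
  rw [mul_summandIncl p _ h, ← proj_mul, ← Mult.central, proj_mul, proj_summandIncl_self,
    ← mul_summandIncl]

variable (𝒜) in
/-- The inclusion `A_p ⊗ A_q → A ⊗ A`. -/
def incl₂ (p q : G) : 𝒜 p ⊗[ℂ] 𝒜 q →ₗ[ℂ] A ⊗[ℂ] A :=
  TensorProduct.map (summandIncl 𝒜 p) (summandIncl 𝒜 q)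

/-- The projection `A ⊗ A → A_p ⊗ A_q`. -/
def proj₂ (h : IsAlgebraDirectSum 𝒜) (p q : G) : A ⊗[ℂ] A →ₗ[ℂ] 𝒜 p ⊗[ℂ] 𝒜 q :=
  TensorProduct.map (h.proj p) (h.proj q)

@[simp] theorem incl₂_tmul (p q : G) (a : 𝒜 p) (b : 𝒜 q) :
    incl₂ 𝒜 p q (a ⊗ₜ b) = summandIncl 𝒜 p a ⊗ₜ summandIncl 𝒜 q b := rfl

@[simp] theorem proj₂_tmul (h : IsAlgebraDirectSum 𝒜) (p q : G) (a b : A) :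
    h.proj₂ p q (a ⊗ₜ b) = h.proj p a ⊗ₜ h.proj q b := rfl

theorem proj₂_incl₂ (h : IsAlgebraDirectSum 𝒜) (p q : G) (x : 𝒜 p ⊗[ℂ] 𝒜 q) :
    h.proj₂ p q (incl₂ 𝒜 p q x) = x := by
  induction x using TensorProduct.induction_on with
  | zero => simp
  | add y y' hy hy' => simp only [map_add, hy, hy']
  | tmul u v => simp [proj_summandIncl_self]

theorem incl₂_injective (h : IsAlgebraDirectSum 𝒜) (p q : G) :
    Function.Injective (incl₂ 𝒜 p q) :=
  Function.LeftInverse.injective (h.proj₂_incl₂ p q)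

theorem proj₂_mul (h : IsAlgebraDirectSum 𝒜) (p q : G) (x y : A ⊗[ℂ] A) :
    h.proj₂ p q (x * y) = h.proj₂ p q x * h.proj₂ p q y := by
  induction x using TensorProduct.induction_on with
  | zero => simp
  | add x x' hx hx' => simp only [add_mul, map_add, hx, hx']
  | tmul a b =>
    induction y using TensorProduct.induction_on with
    | zero => simp
    | add y y' hy hy' => simp only [mul_add, map_add, hy, hy']
    | tmul c d => simp [proj_mul]

theorem incl₂_l2 (p q : G) (b : 𝒜 q) (x : 𝒜 p ⊗[ℂ] 𝒜 q) :
    incl₂ 𝒜 p q (l2 _ b x) = l2 A (summandIncl 𝒜 q b) (incl₂ 𝒜 p q x) := by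
  induction x using TensorProduct.induction_on with
  | zero => simp
  | add x x' hx hx' => simp only [map_add, hx, hx']
  | tmul c d => simp; rfl

theorem incl₂_r2 (p q : G) (b : 𝒜 q) (x : 𝒜 p ⊗[ℂ] 𝒜 q) :
    incl₂ 𝒜 p q (r2 _ b x) = r2 A (summandIncl 𝒜 q b) (incl₂ 𝒜 p q x) := by
  induction x using TensorProduct.induction_on with
  | zero => simp
  | add x x' hx hx' => simp only [map_add, hx, hx']
  | tmul c d => simp; rfl

theorem r2_incl₂_proj₂ (h : IsAlgebraDirectSum 𝒜) (p q : G) (c : A) (y : A ⊗[ℂ] A) :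
    r2 A c (incl₂ 𝒜 p q (h.proj₂ p q y)) = incl₂ 𝒜 p q (h.proj₂ p q (r2 A c y)) := by
  induction y using TensorProduct.induction_on with
  | zero => simp
  | add x x' hx hx' => simp only [map_add, hx, hx']
  | tmul u v => simp [proj_mul, summandIncl_mul _ _ h]

theorem sliceL_incl₂ (φ : A →ₗ[ℂ] ℂ) (p q : G) (x : 𝒜 p ⊗[ℂ] 𝒜 q) :
    sliceL A φ (incl₂ 𝒜 p q x) =
      summandIncl 𝒜 q (sliceL (𝒜 q) (φ ∘ₗ summandIncl 𝒜 p) x) := by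
  induction x using TensorProduct.induction_on with
  | zero => simp
  | add x x' hx hx' => simp only [map_add, hx, hx']
  | tmul u v => simp

theorem l2_incl₂_of_ne (h : IsAlgebraDirectSum 𝒜) {p q r : G} (hqr : r ≠ q) (b : 𝒜 r)
    (x : 𝒜 p ⊗[ℂ] 𝒜 q) : l2 A (summandIncl 𝒜 r b) (incl₂ 𝒜 p q x) = 0 := by
  induction x using TensorProduct.induction_on with
  | zero => simp
  | add x x' hx hx' => simp only [map_add, hx, hx', add_zero]
  | tmul u v =>
    have : summandIncl 𝒜 r b * summandIncl 𝒜 q v = 0 := h.mul_eq_zero r q hqr _ b.2 _ v.2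
    simp [this]

end IsAlgebraDirectSum

/-! ### Graded canonical maps, extension to multipliers and the components of `δ` -/

namespace IsCograding

open IsAlgebraDirectSum

variable [Group G] {Δ : A → Mult (A ⊗[ℂ] A)}

theorem P_mem (h : IsCograding Δ 𝒜) (H : CoverMaps Δ) {p q : G} {a b : A}
    (ha : a ∈ 𝒜 (p * q)) (hb : b ∈ 𝒜 q) : ∃ w, H.P b a = incl₂ 𝒜 p q w := by
  have hm : Mult.incl (H.P b a) ∈ Submodule.span ℂ
      {m | ∃ a ∈ 𝒜 p, ∃ b ∈ 𝒜 q, m = Mult.incl (a ⊗ₜ[ℂ] b)} := by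
    rw [← h.span_right, H.incl_P]
    exact Submodule.subset_span ⟨a, ha, b, hb, rfl⟩
  have : ∃ w, Mult.incl (H.P b a) = Mult.incl (incl₂ 𝒜 p q w) := by
    generalize Mult.incl (H.P b a) = m at hm
    induction hm using Submodule.span_induction with
    | mem x hx =>
      obtain ⟨a, ha, b, hb, rfl⟩ := hx
      exact ⟨(⟨a, ha⟩ : 𝒜 p) ⊗ₜ (⟨b, hb⟩ : 𝒜 q), rfl⟩
    | zero => exact ⟨0, Mult.ext' (by simp) (fun x => by simp; rfl)⟩
    | add x y _ _ hx hy =>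
      obtain ⟨w, rfl⟩ := hx
      obtain ⟨w', rfl⟩ := hy
      exact ⟨w + w', by rw [map_add, Mult.incl_add]⟩
    | smul r x _ hx =>
      obtain ⟨w, rfl⟩ := hx
      exact ⟨r • w, by rw [map_smul, Mult.incl_smul]⟩
  obtain ⟨w, hw⟩ := this
  exact ⟨w, Mult.incl_injective H.nondeg₂ hw⟩

theorem Q_mem (h : IsCograding Δ 𝒜) (H : CoverMaps Δ) {p q : G} {a b : A}
    (ha : a ∈ 𝒜 p) (hb : b ∈ 𝒜 (p * q)) : ∃ w, H.Q a b = incl₂ 𝒜 p q w := by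
  have hm : Mult.incl (H.Q a b) ∈ Submodule.span ℂ
      {m | ∃ a ∈ 𝒜 p, ∃ b ∈ 𝒜 q, m = Mult.incl (a ⊗ₜ[ℂ] b)} := by
    rw [← h.span_left, H.incl_Q]
    exact Submodule.subset_span ⟨a, ha, b, hb, rfl⟩
  have : ∃ w, Mult.incl (H.Q a b) = Mult.incl (incl₂ 𝒜 p q w) := by
    generalize Mult.incl (H.Q a b) = m at hm
    induction hm using Submodule.span_induction with
    | mem x hx =>
      obtain ⟨a, ha, b, hb, rfl⟩ := hx
      exact ⟨(⟨a, ha⟩ : 𝒜 p) ⊗ₜ (⟨b, hb⟩ : 𝒜 q), rfl⟩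
    | zero => exact ⟨0, Mult.ext' (by simp) (fun x => by simp; rfl)⟩
    | add x y _ _ hx hy =>
      obtain ⟨w, rfl⟩ := hx
      obtain ⟨w', rfl⟩ := hy
      exact ⟨w + w', by rw [map_add, Mult.incl_add]⟩
    | smul r x _ hx =>
      obtain ⟨w, rfl⟩ := hx
      exact ⟨r • w, by rw [map_smul, Mult.incl_smul]⟩
  obtain ⟨w, hw⟩ := this
  exact ⟨w, Mult.incl_injective H.nondeg₂ hw⟩

/-- `b ⊗ a ↦ Δ_{p,q}(a)(1 ⊗ b)`. -/
def gradedP (h : IsCograding Δ 𝒜) (H : CoverMaps Δ) (p q : G) :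
    𝒜 q ⊗[ℂ] 𝒜 (p * q) →ₗ[ℂ] 𝒜 p ⊗[ℂ] 𝒜 q :=
  h.proj₂ p q ∘ₗ H.TP.toLinearMap ∘ₗ incl₂ 𝒜 q (p * q)

/-- `b ⊗ a ↦ (b ⊗ 1)Δ_{p,q}(a)`. -/
def gradedQ (h : IsCograding Δ 𝒜) (H : CoverMaps Δ) (p q : G) :
    𝒜 p ⊗[ℂ] 𝒜 (p * q) →ₗ[ℂ] 𝒜 p ⊗[ℂ] 𝒜 q :=
  h.proj₂ p q ∘ₗ H.TQ.toLinearMap ∘ₗ incl₂ 𝒜 p (p * q)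

theorem incl₂_gradedP (h : IsCograding Δ 𝒜) (H : CoverMaps Δ) (p q : G)
    (w : 𝒜 q ⊗[ℂ] 𝒜 (p * q)) :
    incl₂ 𝒜 p q (h.gradedP H p q w) = H.TP (incl₂ 𝒜 q (p * q) w) := by
  induction w using TensorProduct.induction_on with
  | zero => simp
  | add x x' hx hx' => simp only [map_add, hx, hx']
  | tmul b a =>
    obtain ⟨w, hw⟩ := h.P_mem H a.2 b.2
    have hw' : H.TP (incl₂ 𝒜 q (p * q) (b ⊗ₜ a)) = incl₂ 𝒜 p q w := hw
    rw [gradedP, LinearMap.comp_apply, LinearMap.comp_apply, LinearEquiv.coe_coe, hw', proj₂_incl₂]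

theorem incl₂_gradedQ (h : IsCograding Δ 𝒜) (H : CoverMaps Δ) (p q : G)
    (w : 𝒜 p ⊗[ℂ] 𝒜 (p * q)) :
    incl₂ 𝒜 p q (h.gradedQ H p q w) = H.TQ (incl₂ 𝒜 p (p * q) w) := by
  induction w using TensorProduct.induction_on with
  | zero => simp
  | add x x' hx hx' => simp only [map_add, hx, hx']
  | tmul b a =>
    obtain ⟨w, hw⟩ := h.Q_mem H b.2 a.2
    have hw' : H.TQ (incl₂ 𝒜 p (p * q) (b ⊗ₜ a)) = incl₂ 𝒜 p q w := hw
    rw [gradedQ, LinearMap.comp_apply, LinearMap.comp_apply, LinearEquiv.coe_coe, hw', proj₂_incl₂]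

/-- Injectivity is inherited from `TP`; surjectivity is the equality of spans in the cograding. -/
theorem gradedP_bijective (h : IsCograding Δ 𝒜) (H : CoverMaps Δ) (p q : G) :
    Function.Bijective (h.gradedP H p q) := by
  constructor
  · intro w w' hw
    apply h.incl₂_injective
    apply H.TP.injective
    rw [← incl₂_gradedP h, ← incl₂_gradedP h, hw]
  · intro x
    induction x using TensorProduct.induction_on with
    | zero => exact ⟨0, map_zero _⟩
    | add x y hx hy =>
      obtain ⟨w, rfl⟩ := hx
      obtain ⟨w', rfl⟩ := hy
      exact ⟨w + w', map_add _ _ _⟩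
    | tmul a b =>
      have hm : Mult.incl (incl₂ 𝒜 p q (a ⊗ₜ b)) ∈ Submodule.span ℂ
          {m | ∃ a ∈ 𝒜 (p * q), ∃ b ∈ 𝒜 q, m = Δ a * Mult.tmul 1 (Mult.incl b)} := by
        rw [h.span_right]
        exact Submodule.subset_span ⟨a, a.2, b, b.2, rfl⟩
      have : ∃ w, Mult.incl (incl₂ 𝒜 p q (a ⊗ₜ b)) =
          Mult.incl (incl₂ 𝒜 p q (h.gradedP H p q w)) := by
        generalize Mult.incl (incl₂ 𝒜 p q (a ⊗ₜ b)) = m at hm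
        induction hm using Submodule.span_induction with
        | mem x hx =>
          obtain ⟨a, ha, b, hb, rfl⟩ := hx
          refine ⟨(⟨b, hb⟩ : 𝒜 q) ⊗ₜ (⟨a, ha⟩ : 𝒜 (p * q)), ?_⟩
          rw [incl₂_gradedP, ← H.incl_P]
          rfl
        | zero => exact ⟨0, Mult.ext' (by simp) (fun x => by simp; rfl)⟩
        | add x y _ _ hx hy =>
          obtain ⟨w, rfl⟩ := hx
          obtain ⟨w', rfl⟩ := hy
          exact ⟨w + w', by rw [map_add, map_add, Mult.incl_add]⟩
        | smul r x _ hx =>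
          obtain ⟨w, rfl⟩ := hx
          exact ⟨r • w, by rw [map_smul, map_smul, Mult.incl_smul]⟩
      obtain ⟨w, hw⟩ := this
      exact ⟨w, (h.incl₂_injective p q (Mult.incl_injective H.nondeg₂ hw)).symm⟩

theorem gradedQ_bijective (h : IsCograding Δ 𝒜) (H : CoverMaps Δ) (p q : G) :
    Function.Bijective (h.gradedQ H p q) := by
  constructor
  · intro w w' hw
    apply h.incl₂_injective
    apply H.TQ.injective
    rw [← incl₂_gradedQ h, ← incl₂_gradedQ h, hw]
  · intro x
    induction x using TensorProduct.induction_on with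
    | zero => exact ⟨0, map_zero _⟩
    | add x y hx hy =>
      obtain ⟨w, rfl⟩ := hx
      obtain ⟨w', rfl⟩ := hy
      exact ⟨w + w', map_add _ _ _⟩
    | tmul a b =>
      have hm : Mult.incl (incl₂ 𝒜 p q (a ⊗ₜ b)) ∈ Submodule.span ℂ
          {m | ∃ a ∈ 𝒜 p, ∃ b ∈ 𝒜 (p * q), m = Mult.tmul (Mult.incl a) 1 * Δ b} := by
        rw [h.span_left]
        exact Submodule.subset_span ⟨a, a.2, b, b.2, rfl⟩
      have : ∃ w, Mult.incl (incl₂ 𝒜 p q (a ⊗ₜ b)) =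
          Mult.incl (incl₂ 𝒜 p q (h.gradedQ H p q w)) := by
        generalize Mult.incl (incl₂ 𝒜 p q (a ⊗ₜ b)) = m at hm
        induction hm using Submodule.span_induction with
        | mem x hx =>
          obtain ⟨a, ha, b, hb, rfl⟩ := hx
          refine ⟨(⟨a, ha⟩ : 𝒜 p) ⊗ₜ (⟨b, hb⟩ : 𝒜 (p * q)), ?_⟩
          rw [incl₂_gradedQ, ← H.incl_Q]
          rfl
        | zero => exact ⟨0, Mult.ext' (by simp) (fun x => by simp; rfl)⟩
        | add x y _ _ hx hy =>
          obtain ⟨w, rfl⟩ := hx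
          obtain ⟨w', rfl⟩ := hy
          exact ⟨w + w', by rw [map_add, map_add, Mult.incl_add]⟩
        | smul r x _ hx =>
          obtain ⟨w, rfl⟩ := hx
          exact ⟨r • w, by rw [map_smul, map_smul, Mult.incl_smul]⟩
      obtain ⟨w, hw⟩ := this
      exact ⟨w, (h.incl₂_injective p q (Mult.incl_injective H.nondeg₂ hw)).symm⟩

theorem coprod_left (h : IsCograding Δ 𝒜) (p q : G) (a : 𝒜 (p * q)) (x : 𝒜 p ⊗[ℂ] 𝒜 q) :
    (h.coprod Δ p q a).left x = h.proj₂ p q ((Δ a).left (incl₂ 𝒜 p q x)) := rfl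

theorem nondeg₂ (h : IsCograding Δ 𝒜) (H : CoverMaps Δ) (p q : G) :
    NondegenerateProduct (𝒜 p ⊗[ℂ] 𝒜 q) :=
  (h.nondegenerate H.nondeg p).tensor (h.nondegenerate H.nondeg q)

theorem coprod_left_gradedP (h : IsCograding Δ 𝒜) (H : CoverMaps Δ) (p q : G)
    (a c : 𝒜 (p * q)) (b : 𝒜 q) :
    (h.coprod Δ p q a).left (h.gradedP H p q (b ⊗ₜ c)) = h.gradedP H p q (b ⊗ₜ (a * c)) := by
  rw [h.coprod_left p q, h.incl₂_gradedP H, H.left_TP, incl₂_tmul, l2_tmul]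
  rfl

/-- A multiplier of `A_p ⊗ A_q` is determined by its products with the `Δ_{p,q}(a)(1 ⊗ b)`. -/
theorem mult_ext (h : IsCograding Δ 𝒜) (H : CoverMaps Δ) {p q : G}
    {m n : Mult (𝒜 p ⊗[ℂ] 𝒜 q)} (hmn : ∀ b c, m.left (h.gradedP H p q (b ⊗ₜ c)) =
      n.left (h.gradedP H p q (b ⊗ₜ c))) : m = n := by
  refine Mult.ext_left (h.nondeg₂ H p q) fun x => ?_
  obtain ⟨w, rfl⟩ := (h.gradedP_bijective H p q).2 x
  induction w using TensorProduct.induction_on with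
  | zero => simp
  | add x x' hx hx' => simp only [map_add, hx, hx']
  | tmul b a => exact hmn b a

theorem incl_gradedP (h : IsCograding Δ 𝒜) (H : CoverMaps Δ) (p q : G)
    (a : 𝒜 (p * q)) (b : 𝒜 q) :
    Mult.incl (h.gradedP H p q (b ⊗ₜ a)) = h.coprod Δ p q a * Mult.tmul 1 (Mult.incl b) := by
  refine Mult.ext_left (h.nondeg₂ H p q) fun x => ?_
  have h₁ : incl₂ 𝒜 p q (l2 _ b x) =
      (Mult.tmul 1 (Mult.incl (summandIncl 𝒜 q b))).left (incl₂ 𝒜 p q x) := incl₂_l2 p q b x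
  have h₂ : (h.coprod Δ p q a * Mult.tmul 1 (Mult.incl b)).left x =
      h.proj₂ p q ((Δ a).left (incl₂ 𝒜 p q (l2 _ b x))) := rfl
  rw [h₂, h₁, ← Mult.left_mul, ← H.incl_P, Mult.left_incl, Mult.left_incl, proj₂_mul, proj₂_incl₂]
  rfl

theorem incl_gradedQ (h : IsCograding Δ 𝒜) (H : CoverMaps Δ) (p q : G)
    (a : 𝒜 (p * q)) (b : 𝒜 p) :
    Mult.incl (h.gradedQ H p q (b ⊗ₜ a)) = Mult.tmul (Mult.incl b) 1 * h.coprod Δ p q a := by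
  refine Mult.ext_right (h.nondeg₂ H p q) fun x => ?_
  have h₁ : incl₂ 𝒜 p q (r1 _ b x) =
      (Mult.tmul (Mult.incl (summandIncl 𝒜 p b)) 1).right (incl₂ 𝒜 p q x) := by
    induction x using TensorProduct.induction_on with
    | zero => simp
    | add x x' hx hx' => simp only [map_add, hx, hx']
    | tmul c d => rfl
  have h₂ : (Mult.tmul (Mult.incl b) 1 * h.coprod Δ p q a).right x =
      h.proj₂ p q ((Δ a).right (incl₂ 𝒜 p q (r1 _ b x))) := rfl
  rw [h₂, h₁, ← Mult.right_mul, ← H.incl_Q, Mult.right_incl, Mult.right_incl, proj₂_mul,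
    proj₂_incl₂]
  rfl

theorem incl_proj₂_L (h : IsCograding Δ 𝒜) (H : CoverMaps Δ) (p q : G)
    (a : 𝒜 (p * q)) (b : 𝒜 q) :
    Mult.incl (h.proj₂ p q (H.L b a)) = Mult.tmul 1 (Mult.incl b) * h.coprod Δ p q a := by
  refine Mult.ext_right (h.nondeg₂ H p q) fun x => ?_
  have h₁ : incl₂ 𝒜 p q (r2 _ b x) =
      (Mult.tmul 1 (Mult.incl (summandIncl 𝒜 q b))).right (incl₂ 𝒜 p q x) := incl₂_r2 p q b x
  have h₂ : (Mult.tmul 1 (Mult.incl b) * h.coprod Δ p q a).right x =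
      h.proj₂ p q ((Δ a).right (incl₂ 𝒜 p q (r2 _ b x))) := rfl
  rw [h₂, h₁, ← Mult.right_mul, ← H.incl_L, Mult.right_incl, Mult.right_incl, proj₂_mul,
    proj₂_incl₂]
  rfl

/-- The cograding axioms do not mention `(1 ⊗ b)Δ(a)`. Multiplied by `1 ⊗ c` from the right, with
`c` in `A_s`, it is `1 ⊗ b` times an element of `A_{pqs⁻¹} ⊗ A_s`, which vanishes unless `s = q`. -/
theorem incl₂_proj₂_L (h : IsCograding Δ 𝒜) (H : CoverMaps Δ) (p q : G)
    (a : 𝒜 (p * q)) (b : 𝒜 q) : incl₂ 𝒜 p q (h.proj₂ p q (H.L b a)) = H.L b a := by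
  refine ext_r2 H.nondeg fun c => ?_
  rw [r2_incl₂_proj₂, ← H.l2_P]
  refine h.sum_induction (P := fun c => incl₂ 𝒜 p q (h.proj₂ p q (l2 A (b : A) (H.P c a))) =
    l2 A (b : A) (H.P c a)) ?_ ?_ ?_ c
  · simp [← H.TP_tmul]
  · intro x y hx hy
    have : H.P (x + y) a = H.P x a + H.P y a := by simp [← H.TP_tmul, TensorProduct.add_tmul]
    rw [this, map_add, map_add, map_add, hx, hy]
  · intro s c
    by_cases hs : s = q
    · subst hs
      obtain ⟨w, hw⟩ := h.P_mem H a.2 c.2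
      have hw' : H.P (summandIncl 𝒜 s c) a = incl₂ 𝒜 p s w := hw
      have := incl₂_l2 p s b w
      change _ = l2 A (b : A) _ at this
      rw [hw', ← this, proj₂_incl₂]
    -- The degree `pq` is refactored so that its second factor is the degree `s` of `c`.
    · have ha : (a : A) ∈ 𝒜 (p * q * s⁻¹ * s) := by
        rw [inv_mul_cancel_right]
        exact a.2
      obtain ⟨w, hw⟩ := h.P_mem H ha c.2
      have hw' : H.P (summandIncl 𝒜 s c) a = incl₂ 𝒜 (p * q * s⁻¹) s w := hw
      have h0 : l2 A (b : A) (incl₂ 𝒜 (p * q * s⁻¹) s w) = 0 :=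
        h.l2_incl₂_of_ne (Ne.symm hs) b w
      rw [hw', h0, map_zero, map_zero]

theorem coprod_mul (h : IsCograding Δ 𝒜) (H : CoverMaps Δ) (p q : G) (a b : 𝒜 (p * q)) :
    h.coprod Δ p q (a * b) = h.coprod Δ p q a * h.coprod Δ p q b :=
  h.mult_ext H fun c d => by
    rw [Mult.left_mul, coprod_left_gradedP, coprod_left_gradedP, coprod_left_gradedP, mul_assoc]

/-- Both sides are `(b ⊗ 1)Δ(cmc')(1 ⊗ b')` on elementary tensors. This is the compatibility of left
and right actions required of the extension. -/
theorem gradedQ_mul_gradedP (h : IsCograding Δ 𝒜) (H : CoverMaps Δ) (p q : G)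
    (m : Mult (𝒜 (p * q))) (w : 𝒜 p ⊗[ℂ] 𝒜 (p * q)) (w' : 𝒜 q ⊗[ℂ] 𝒜 (p * q)) :
    h.gradedQ H p q (m.right.lTensor _ w) * h.gradedP H p q w' =
      h.gradedQ H p q w * h.gradedP H p q (m.left.lTensor _ w') := by
  induction w using TensorProduct.induction_on with
  | zero => simp
  | add x x' hx hx' => simp only [map_add, add_mul, hx, hx']
  | tmul b c =>
    induction w' using TensorProduct.induction_on with
    | zero => simp
    | add x x' hx hx' => simp only [map_add, mul_add, hx, hx']
    | tmul b' c' =>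
      apply Mult.incl_injective (h.nondeg₂ H p q)
      simp only [LinearMap.lTensor_tmul]
      have assoc₄ : ∀ x y z t : Mult (𝒜 p ⊗[ℂ] 𝒜 q), x * y * (z * t) = x * (y * z) * t := by
        intros; simp only [mul_assoc]
      rw [Mult.incl_mul, Mult.incl_mul, incl_gradedQ, incl_gradedQ, incl_gradedP, incl_gradedP,
        assoc₄, assoc₄, ← h.coprod_mul H, ← h.coprod_mul H, m.central]

/-- The extension of `Δ_{p,q}` to `M(A_{pq})`. -/
def extension (h : IsCograding Δ 𝒜) (H : CoverMaps Δ) (p q : G) (m : Mult (𝒜 (p * q))) :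
    Mult (𝒜 p ⊗[ℂ] 𝒜 q) :=
  let TP := LinearEquiv.ofBijective _ (h.gradedP_bijective H p q)
  let TQ := LinearEquiv.ofBijective _ (h.gradedQ_bijective H p q)
  Mult.mk (TP.toLinearMap ∘ₗ m.left.lTensor _ ∘ₗ TP.symm.toLinearMap)
    (TQ.toLinearMap ∘ₗ m.right.lTensor _ ∘ₗ TQ.symm.toLinearMap) (by
      intro x y
      obtain ⟨w, rfl⟩ := TQ.surjective x
      obtain ⟨w', rfl⟩ := TP.surjective y
      simp only [LinearMap.comp_apply, LinearEquiv.coe_coe, LinearEquiv.symm_apply_apply]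
      exact h.gradedQ_mul_gradedP H p q m w w')

theorem extension_left (h : IsCograding Δ 𝒜) (H : CoverMaps Δ) (p q : G)
    (m : Mult (𝒜 (p * q))) (b : 𝒜 q) (c : 𝒜 (p * q)) :
    (h.extension H p q m).left (h.gradedP H p q (b ⊗ₜ c)) =
      h.gradedP H p q (b ⊗ₜ m.left c) := by
  have : h.gradedP H p q (b ⊗ₜ c) =
    LinearEquiv.ofBijective _ (h.gradedP_bijective H p q) (b ⊗ₜ c) := rfl
  simp only [extension, Mult.left_mk, LinearMap.comp_apply, LinearEquiv.coe_coe]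
  rw [this, LinearEquiv.symm_apply_apply]
  rfl

/-- Multiplicativity of `D` and `mc ∈ A_{pq}` determine `D(m)` on the elements `Δ_{p,q}(c)(1 ⊗ b)`.
They span `A_p ⊗ A_q`, whence uniqueness. -/
theorem left_of_isMultExtension (h : IsCograding Δ 𝒜) (H : CoverMaps Δ) {p q : G}
    {D : Mult (𝒜 (p * q)) →ₐ[ℂ] Mult (𝒜 p ⊗[ℂ] 𝒜 q)}
    (hD : IsMultExtension (h.coprod Δ p q) D) (m : Mult (𝒜 (p * q))) (b : 𝒜 q)
    (c : 𝒜 (p * q)) :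
    (D m).left (h.gradedP H p q (b ⊗ₜ c)) = h.gradedP H p q (b ⊗ₜ m.left c) := by
  apply Mult.incl_injective (h.nondeg₂ H p q)
  rw [Mult.incl_left (h.nondeg₂ H p q), incl_gradedP, incl_gradedP, ← hD, ← hD, ← mul_assoc,
    ← map_mul, Mult.incl_left (h.nondegenerate H.nondeg _)]

theorem existsUnique_isMultExtension (h : IsCograding Δ 𝒜) (H : CoverMaps Δ) (p q : G) :
    ∃! D : Mult (𝒜 (p * q)) →ₐ[ℂ] Mult (𝒜 p ⊗[ℂ] 𝒜 q),
      IsMultExtension (h.coprod Δ p q) D := by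
  let D₀ : Mult (𝒜 (p * q)) →ₗ[ℂ] Mult (𝒜 p ⊗[ℂ] 𝒜 q) :=
    { toFun := h.extension H p q
      map_add' := fun m n => h.mult_ext H fun b c => by
        simp [extension_left, TensorProduct.tmul_add]
      map_smul' := fun r m => h.mult_ext H fun b c => by
        simp [extension_left] }
  have hD₀ : ∀ m b c, (D₀ m).left (h.gradedP H p q (b ⊗ₜ c)) =
      h.gradedP H p q (b ⊗ₜ m.left c) := h.extension_left H p q
  refine ⟨AlgHom.ofLinearMap D₀ (h.mult_ext H fun b c => by simp [hD₀])
    (fun m n => h.mult_ext H fun b c => by simp [hD₀]), fun a => ?_, fun D hD => ?_⟩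
  · refine h.mult_ext H fun b c => ?_
    rw [coprod_left_gradedP, AlgHom.ofLinearMap_apply, hD₀, Mult.left_incl]
  · refine AlgHom.ext fun m => h.mult_ext H fun b c => ?_
    rw [h.left_of_isMultExtension H hD, AlgHom.ofLinearMap_apply, hD₀]

/-- The products with `1 ⊗ b` on either side already lie in `A_p ⊗ A_q`, so their slices by `φ_p`
agree with the global slices by `φ`. -/
theorem isLeftSlice_coprod (h : IsCograding Δ 𝒜) (H : CoverMaps Δ) {φ : A →ₗ[ℂ] ℂ} {δ : Mult A}
    (hδ : IsModularElement Δ φ δ) (p q : G) (a : 𝒜 (p * q)) :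
    IsLeftSlice (φ ∘ₗ summandIncl 𝒜 p) (h.coprod Δ p q a)
      ((φ ∘ₗ summandIncl 𝒜 (p * q)) a • h.component q δ) := by
  obtain ⟨hl, hr⟩ := H.isModularElement_iff.1 hδ
  intro b
  refine ⟨⟨_, h.incl_gradedP H p q a b, ?_⟩, ⟨_, h.incl_proj₂_L H p q a b, ?_⟩⟩
  · change sliceL (𝒜 q) _ _ = φ a • h.proj q (δ.left b)
    rw [← h.proj_summandIncl_self q (sliceL _ _ _), ← sliceL_incl₂, h.incl₂_gradedP H, ← map_smul,
      ← hl]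
    rfl
  · change sliceL (𝒜 q) _ _ = φ a • h.proj q (δ.right b)
    rw [← h.proj_summandIncl_self q (sliceL _ _ _), ← sliceL_incl₂, h.incl₂_proj₂_L H, ← map_smul,
      ← hr]

/-- On the spanning elements `Δ_{p,q}(c)(1 ⊗ b)` both sides embed in `A ⊗ A` as the two sides of
`map_modular_P`. -/
theorem extension_modular_left (h : IsCograding Δ 𝒜) (H : CoverMaps Δ) {φ : A →ₗ[ℂ] ℂ}
    (hφ : IsLeftIntegral Δ φ) {δ : Mult A} (hδ : IsModularElement Δ φ δ) {p q : G}
    {D : Mult (𝒜 (p * q)) →ₐ[ℂ] Mult (𝒜 p ⊗[ℂ] 𝒜 q)}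
    (hD : IsMultExtension (h.coprod Δ p q) D) (x : 𝒜 p ⊗[ℂ] 𝒜 q) :
    (D (h.component (p * q) δ)).left x =
      TensorProduct.map (h.component p δ).left (h.component q δ).left x := by
  have hmap : ∀ x : 𝒜 p ⊗[ℂ] 𝒜 q, incl₂ 𝒜 p q
      (TensorProduct.map (h.component p δ).left (h.component q δ).left x) =
      TensorProduct.map δ.left δ.left (incl₂ 𝒜 p q x) := by
    intro x
    induction x using TensorProduct.induction_on with
    | zero => simp
    | add x x' hx hx' => simp only [map_add, hx, hx']
    | tmul b c => simp [h.summandIncl_component_left H.nondeg]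
  obtain ⟨w, rfl⟩ := (h.gradedP_bijective H p q).2 x
  induction w using TensorProduct.induction_on with
  | zero => simp
  | add x x' hx hx' => simp only [map_add, hx, hx']
  | tmul b c =>
    rw [h.left_of_isMultExtension H hD]
    apply h.incl₂_injective
    rw [hmap, incl₂_gradedP, incl₂_gradedP, incl₂_tmul, incl₂_tmul,
      h.summandIncl_component_left H.nondeg, H.TP_tmul, H.TP_tmul, H.map_modular_P hφ hδ]

end IsCograding

end Graded

end CogradedMHA

end

theorem proposition2p5
    {G : Type*} [Group G] [DecidableEq G]
    {A : Type*} [NonUnitalRing A] [Module ℂ A] [SMulCommClass ℂ A A] [IsScalarTower ℂ A A]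
    (Δ : A → CogradedMHA.Mult (A ⊗[ℂ] A))
    (hΔ : CogradedMHA.IsRegularMultiplierHopfAlgebra Δ)
    (𝒜 : G → NonUnitalSubalgebra ℂ A)
    (h𝒜 : CogradedMHA.IsCograding Δ 𝒜)
    (φ : A →ₗ[ℂ] ℂ)
    (hφ : CogradedMHA.IsLeftIntegral Δ φ) :
    -- the modular element `δ` of `φ` exists and is unique
    (∃! δ : CogradedMHA.Mult A, CogradedMHA.IsModularElement Δ φ δ) ∧
    ∀ δ : CogradedMHA.Mult A, CogradedMHA.IsModularElement Δ φ δ →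
      -- `(φ_p ⊗ ι)Δ_{p,q}(a) = φ_{pq}(a)δ_q`
      (∀ (p q : G) (a : 𝒜 (p * q)),
        CogradedMHA.IsLeftSlice (φ ∘ₗ CogradedMHA.summandIncl 𝒜 p)
          (h𝒜.coprod Δ p q a)
          ((φ ∘ₗ CogradedMHA.summandIncl 𝒜 (p * q)) a • h𝒜.component q δ)) ∧
      -- `Δ_{p,q}` has a unique extension to `M(A_{pq})`, and
      -- `Δ_{p,q}(δ_{pq})(b ⊗ c) = δ_p b ⊗ δ_q c`
      (∀ p q : G,
        (∃! D : CogradedMHA.Mult (𝒜 (p * q)) →ₐ[ℂ] CogradedMHA.Mult (𝒜 p ⊗[ℂ] 𝒜 q),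
          CogradedMHA.IsMultExtension (h𝒜.coprod Δ p q) D) ∧
        ∀ D : CogradedMHA.Mult (𝒜 (p * q)) →ₐ[ℂ] CogradedMHA.Mult (𝒜 p ⊗[ℂ] 𝒜 q),
          CogradedMHA.IsMultExtension (h𝒜.coprod Δ p q) D →
          ∀ (b : 𝒜 p) (c : 𝒜 q),
            (D (h𝒜.component (p * q) δ)).left (b ⊗ₜ[ℂ] c) =
              (h𝒜.component p δ).left b ⊗ₜ[ℂ] (h𝒜.component q δ).left c) := by
  obtain ⟨H⟩ := hΔ.nonempty_coverMaps
  refine ⟨H.existsUnique_isModularElement hφ, fun δ hδ => ⟨h𝒜.isLeftSlice_coprod H hδ,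
    fun p q => ⟨h𝒜.existsUnique_isMultExtension H p q, fun D hD b c => ?_⟩⟩⟩
  rw [h𝒜.extension_modular_left H hφ hδ hD, TensorProduct.map_tmul]
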